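/- Model. A network is a connected graph $G=(V,E)$ with $n=|V|\ge 2$ vertices, which carry distinct identifiers from $\{0,\dots,n^{d}-1\}$ for a fixed constant $d$. Computation proceeds in synchronous rounds; in each round every vertex may send a (different) message to each of its neighbours, receives the messages of its neighbours, and performs arbitrary local computation. In the CONGEST model every message has $O(\log n)$ bits. Initially every vertex knows the parameter $k$, its own identifier, its degree and the outcome of its own private fair coin flips (but neither $n$ nor the identifiers of its neighbours). An algorithm solves $k$-MVC on $G$ if the following holds: when $G$ has a vertex cover of at most $k$ vertices, every vertex outputs whether it belongs to the computed set, and this set is a vertex cover of $G$ with at most $k$ vertices; when $G$ has no such vertex cover, every vertex reports that there is none. Theorem. For any $\delta = k^{-O(1)}$ there is a randomized CONGEST algorithm for $k$-MVC that terminates in $O\!\left(k + \frac{k^2\log k}{\log n}\right)$ rounds and is correct with probability at least $1-\delta$. Precisely: for every $d\in\mathbb N$ there is a constant $B$ such that for every $c\in\mathbb R$ there is a constant $C$ such that for every function $\delta:\mathbb N\to[0,\infty)$ with $\delta(k)\ge k^{-c}$ for all $k\ge 2$ there is a randomized algorithm which, for every $k\in\mathbb N$ and every network as above, whatever the outcome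 of the coin flips, sends only messages of at most $B\log_2 n$ bits and terminates at every vertex within $C\left(k+\frac{k^2\log k}{\log n}\right)$ rounds, and which solves $k$-MVC with probability at least $1-\delta(k)$. -/

import Mathlib

noncomputable section

namespace Congest

/-- A communication network on the vertex set `V`: a connected graph whose vertices carry distinct
identifiers, and where every vertex `v` addresses its neighbours through ports
`0, …, deg v - 1`, numbered in an arbitrary order. -/
structure Network (V : Type) where
  graph : SimpleGraph V
  connected : graph.Connected
  ident : V → ℕ
  ident_injective : Function.Injective ident
  port : ∀ v : V, Fin (Nat.card (graph.neighborSet v)) ≃ graph.neighborSet v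

/-- The degree of a vertex. -/
def Network.deg {V : Type} (N : Network V) (v : V) : ℕ := Nat.card (N.graph.neighborSet v)

/-- What a vertex may answer: it is in the computed vertex set, it is not, or it reports that
there is no solution of the required size. -/
inductive Verdict
  | inside
  | outside
  | noSolution

/-- A randomized synchronous message passing algorithm, as run by every vertex.
A message is a string of bits; the empty string stands for silence.
Initially a vertex knows its identifier, its degree and the outcome of its own private
coin flips. In each round it sends a message through each of its ports (`send s p` is the message
sent through port `p` in the local state `s`) and computes its new state from its old state and the
messages received, indexed by port. Local computation is unrestricted.
A vertex has terminated as soon as its state has an output. -/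
structure Protocol where
  /-- the number of fair coins that each vertex flips -/
  numCoins : ℕ
  State : Type
  init : (identifier degree : ℕ) → (coins : Fin numCoins → Bool) → State
  send : State → ℕ → List Bool
  receive : State → (ℕ → List Bool) → State
  output : State → Option Verdict

namespace Protocol

variable (A : Protocol)

/-- The message sent through port `p` in state `s`; a terminated vertex is silent. -/
def message (s : A.State) (p : ℕ) : List Bool :=
  if (A.output s).isSome then [] else A.send s p

variable {V : Type} (N : Network V)

/-- The messages that arrive at `v`, indexed by the ports of `v`, when `c` is the family of local
states; the neighbour `u` behind port `p` of `v` sends through its own port that leads to `v`. -/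
def inbox (c : V → A.State) (v : V) (p : ℕ) : List Bool :=
  if h : p < N.deg v then
    let u := N.port v ⟨p, h⟩
    A.message (c u) ((N.port u).symm ⟨v, u.2.symm⟩)
  else []

/-- The outcomes of all coin flips of all vertices. -/
abbrev Coins (V : Type) : Type := V → Fin A.numCoins → Bool

/-- The local states after `t` communication rounds. The state of a terminated vertex no longer
changes, so its output is final. -/
def config (ω : A.Coins V) : ℕ → V → A.State
  | 0 => fun v => A.init (N.ident v) (N.deg v) (ω v)
  | t + 1 => fun v =>
      let c := config ω t
      if (A.output (c v)).isSome then c v else A.receive (c v) (A.inbox N c v)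

/-- The output of `v` after `t` rounds, if it has terminated by then. -/
def result (ω : A.Coins V) (t : ℕ) (v : V) : Option Verdict :=
  A.output (A.config N ω t v)

/-- Whatever the coins, no message that is ever sent has more than `b` bits. -/
def MessagesAtMost (b : ℝ) : Prop :=
  ∀ (ω : A.Coins V) (t : ℕ) (v : V) (p : ℕ), p < N.deg v →
    ((A.message (A.config N ω t v) p).length : ℝ) ≤ b

/-- Whatever the coins, all vertices have terminated after `t` rounds. -/
def TerminatesWithin (t : ℕ) : Prop :=
  ∀ (ω : A.Coins V) (v : V), (A.result N ω t v).isSome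

end Protocol

/-- The family `out` of final answers solves the vertex cover problem with parameter `k` on `G`:
if `G` has a vertex cover with at most `k` vertices, the answers describe such a cover, and
otherwise every vertex reports that there is none. -/
def SolvesVertexCover {V : Type} (G : SimpleGraph V) (k : ℕ) (out : V → Option Verdict) : Prop :=
  ((∃ S : Set V, G.IsVertexCover S ∧ S.ncard ≤ k) →
    (∀ v, out v = some .inside ∨ out v = some .outside) ∧
      G.IsVertexCover {v | out v = some .inside} ∧ {v | out v = some .inside}.ncard ≤ k) ∧
  ((¬ ∃ S : Set V, G.IsVertexCover S ∧ S.ncard ≤ k) →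
    ∀ v, out v = some .noSolution)

open Classical in
/-- The probability, over independent fair coins, that the outputs present after `t` rounds are
correct. -/
def successProbability (A : Protocol) {V : Type} [Fintype V] (N : Network V) (k t : ℕ) : ℝ :=
  (PMF.uniformOfFintype (A.Coins V)).toMeasure.real
    {ω | SolvesVertexCover N.graph k (A.result N ω t)}

end Congest

end

noncomputable section

namespace Congest

open Finset
open scoped Classical

/-! The algorithm lets every vertex collect a kernel of the instance and solve it locally;
randomness only shortens the names of vertices. A connected graph with a vertex cover of size `k`
has diameter at most `2 * k` (`dist_le_two_mul_of_isVertexCover`). Every vertex computes the largest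
identifier within distance `2 * k`, and an alarm travels `4 * k` steps from any two neighbours whose
results differ. Either the alarm reaches everyone, and there is no small cover, or nobody hears it,
all share the global maximum `m`, and the diameter is at most `4 * k` (`networkAlarm_dichotomy`). As
identifiers are distinct and below `n ^ d`, the bit length of `m` is of order `log n` and serves as
common bandwidth. A vertex of degree above `k` lies in every cover of size at most `k`, and a vertex
of smaller degree covers few edges, so the kernel has at most `2 * k ^ 2` ordered pairs if a small
cover exists. Its pairs are flooded in a pipeline (`flood_eq_or_card_le`); a vertex ends up with all
of them or with too many. Random labels of `O(log k)` bits replace identifiers in the kernel, so a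
message holds about `log n / log k` pairs, or a pair takes about `log k / log n` messages; either
way the time is `O(k + k ^ 2 * log k / log n)`. The labels need to be distinct only on the `O(k ^
2)` endpoints of a certificate (`exists_certificate`, `solvesVertexCover_decideVerdict`), and a
union bound over pairs of endpoints makes a collision unlikely (`card_not_injOn_mul_le`). -/

section

/-! ### Encoding of broadcasts and their simulation by short messages. -/

/-- A self-delimiting code for a string of bits. -/
def delimit (l : List Bool) : List Bool := l.flatMap (fun b => [true, b]) ++ [false]

/-- Each bit is preceded by `true` and the end is marked by `false`, so a reader knows where the
word stops. -/
theorem delimit_append_inj (l l' r r' : List Bool) (h : delimit l ++ r = delimit l' ++ r') :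
    l = l' ∧ r = r' := by
  induction l generalizing l' with
  | nil =>
    cases l' with
    | nil => simpa [delimit] using h
    | cons b l' => simp [delimit] at h
  | cons a l ih =>
    cases l' with
    | nil => simp [delimit] at h
    | cons b l' =>
      have h' : a = b ∧ delimit l ++ r = delimit l' ++ r' := by simpa [delimit] using h
      obtain ⟨rfl, h2⟩ := h'
      obtain ⟨rfl, h3⟩ := ih _ h2
      exact ⟨rfl, h3⟩

theorem length_delimit (l : List Bool) : (delimit l).length = 2 * l.length + 1 := by
  induction l with
  | nil => simp [delimit]
  | cons a l ih =>
    simp only [delimit, List.flatMap_cons, List.length_append, List.length_cons] at *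
    simp at *
    omega

theorem bits_injective : Function.Injective Nat.bits := by
  intro x y h
  have := Nat.digits_two_eq_bits x
  rw [h, ← Nat.digits_two_eq_bits y] at this
  exact Nat.digits_inj_iff.mp this

/-- A code for lists of natural numbers. -/
def encodeList (l : List ℕ) : List Bool := l.flatMap fun x => delimit x.bits

theorem encodeList_injective : Function.Injective encodeList := by
  intro l l' h
  induction l generalizing l' with
  | nil =>
    cases l' with
    | nil => rfl
    | cons b l' => simp [encodeList, delimit] at h
  | cons a l ih =>
    cases l' with
    | nil => simp [encodeList, delimit] at h
    | cons b l' =>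
      simp only [encodeList, List.flatMap_cons] at h
      obtain ⟨h1, h2⟩ := delimit_append_inj _ _ _ _ h
      rw [bits_injective h1, ih h2]

/-- A code for finite sets of natural numbers. -/
def encode (s : Finset ℕ) : List Bool := encodeList s.toList

theorem encode_injective : Function.Injective encode := fun s s' h => by
  have := encodeList_injective h
  rw [← Finset.toList_toFinset s, this, Finset.toList_toFinset]

/-- The decoding of finite sets of natural numbers. -/
def decode : List Bool → Finset ℕ := Function.invFun encode

@[simp] theorem decode_encode (s : Finset ℕ) : decode (encode s) = s :=
  Function.leftInverse_invFun encode_injective s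

theorem length_encode (s : Finset ℕ) : (encode s).length = ∑ x ∈ s, (2 * x.size + 1) := by
  rw [encode, encodeList, List.length_flatMap, ← Finset.sum_map_toList]
  simp only [length_delimit, Nat.size_eq_bits_len]

theorem length_encode_le {s : Finset ℕ} {w : ℕ} (h : ∀ x ∈ s, x < 2 ^ w) :
    (encode s).length ≤ #s * (2 * w + 1) := by
  rw [length_encode, ← smul_eq_mul]
  refine Finset.sum_le_card_nsmul _ _ _ fun x hx => ?_
  have := Nat.size_le.mpr (h x hx)
  omega

/-- An algorithm in which every vertex repeatedly broadcasts a finite set of numbers to all its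
neighbours. A broadcast takes `duration` communication rounds, in each of which at most `width`
bits are sent through every port. -/
structure BroadcastAlgorithm where
  /-- the number of fair coins that each vertex flips -/
  numCoins : ℕ
  State : Type
  init : (identifier degree : ℕ) → (coins : Fin numCoins → Bool) → State
  message : State → Finset ℕ
  update : State → Finset (Finset ℕ) → State
  duration : State → ℕ
  width : State → ℕ
  output : State → Option Verdict

namespace BroadcastAlgorithm

variable (A : BroadcastAlgorithm)

/-- The local state of a vertex that is in the middle of a broadcast. -/
structure Progress where
  degree : ℕ
  state : A.State
  elapsed : ℕ
  buffer : ℕ → List Bool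

/-- The protocol that cuts the broadcasts into messages. -/
abbrev toProtocol : Protocol where
  numCoins := A.numCoins
  State := A.Progress
  init i d ω := ⟨d, A.init i d ω, 0, fun _ => []⟩
  send s _ := ((encode (A.message s.state)).drop (s.elapsed * A.width s.state)).take
    (A.width s.state)
  receive s inbox :=
    if s.elapsed + 1 < A.duration s.state then
      ⟨s.degree, s.state, s.elapsed + 1, fun p => s.buffer p ++ inbox p⟩
    else
      ⟨s.degree, A.update s.state ((range s.degree).image fun p => decode (s.buffer p ++ inbox p)),
        0, fun _ => []⟩
  output s := A.output s.state

variable {V : Type} [Fintype V] (N : Network V)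

/-- The local states after a number of broadcasts. -/
def trajectory (ω : V → Fin A.numCoins → Bool) : ℕ → V → A.State
  | 0 => fun v => A.init (N.ident v) (N.deg v) (ω v)
  | i + 1 => fun v => A.update (trajectory ω i v)
      ((N.graph.neighborFinset v).image fun u => A.message (trajectory ω i u))

/-- All vertices run for `I` broadcasts in lockstep, where the `i`-th one takes `D i` rounds. -/
structure Lockstep (ω : V → Fin A.numCoins → Bool) (I : ℕ) (D : ℕ → ℕ) : Prop where
  output_eq_none : ∀ i < I, ∀ v, A.output (A.trajectory N ω i v) = none
  duration_eq : ∀ i < I, ∀ v, A.duration (A.trajectory N ω i v) = D i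
  duration_pos : ∀ i < I, 0 < D i
  length_le : ∀ i < I, ∀ v, (encode (A.message (A.trajectory N ω i v))).length ≤
    D i * A.width (A.trajectory N ω i v)
  halts : ∀ v, (A.output (A.trajectory N ω I v)).isSome

variable {A N} {ω : V → Fin A.numCoins → Bool} {I : ℕ} {D : ℕ → ℕ}

omit [Fintype V] in
theorem inbox_toProtocol (c : V → A.Progress) (v : V) (p : ℕ) (hp : p < N.deg v)
    (hc : A.output (c (N.port v ⟨p, hp⟩)).state = none) :
    A.toProtocol.inbox N c v p =
      ((encode (A.message (c (N.port v ⟨p, hp⟩)).state)).drop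
        ((c (N.port v ⟨p, hp⟩)).elapsed * A.width (c (N.port v ⟨p, hp⟩)).state)).take
        (A.width (c (N.port v ⟨p, hp⟩)).state) := by
  simp only [Protocol.inbox, hp, dif_pos, Protocol.message, hc]
  rfl

/-- An update uses only the set of received messages, so the arbitrary numbering of the ports drops
out. -/
theorem image_port (v : V) {β : Type} [DecidableEq β] (f : V → β) (g : ℕ → β)
    (h : ∀ (p : ℕ) (hp : p < N.deg v), g p = f (N.port v ⟨p, hp⟩)) :
    (range (N.deg v)).image g = (N.graph.neighborFinset v).image f := by
  ext x
  simp only [mem_image, mem_range, SimpleGraph.mem_neighborFinset]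
  constructor
  · rintro ⟨p, hp, rfl⟩
    exact ⟨_, (N.port v ⟨p, hp⟩).2, (h p hp).symm⟩
  · rintro ⟨u, hu, rfl⟩
    refine ⟨(N.port v).symm ⟨u, hu⟩, ((N.port v).symm ⟨u, hu⟩).2, ?_⟩
    rw [h _ ((N.port v).symm ⟨u, hu⟩).2]
    exact congrArg (fun w : N.graph.neighborSet v => f w) ((N.port v).apply_symm_apply ⟨u, hu⟩)

namespace Lockstep

variable (h : A.Lockstep N ω I D)
include h

/-- In the middle of a broadcast the buffer of a port holds the first `j` blocks of the neighbour's
code, cut to the neighbour's own width. -/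
theorem config_add {i : ℕ} (hi : i < I)
    (h0 : A.toProtocol.config N ω (∑ j ∈ range i, D j) =
      fun v => ⟨N.deg v, A.trajectory N ω i v, 0, fun _ => []⟩) (j : ℕ) (hj : j < D i) :
    A.toProtocol.config N ω (∑ j ∈ range i, D j + j) = fun v =>
      ⟨N.deg v, A.trajectory N ω i v, j, fun p => if hp : p < N.deg v then
        (encode (A.message (A.trajectory N ω i (N.port v ⟨p, hp⟩)))).take
          (j * A.width (A.trajectory N ω i (N.port v ⟨p, hp⟩))) else []⟩ := by
  induction j with
  | zero => simp [h0]
  | succ j ih =>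
    have ih := ih (by omega)
    funext v
    rw [← add_assoc, Protocol.config]
    simp only [ih]
    simp only [h.output_eq_none i hi v, Option.isSome_none, Bool.false_eq_true, if_false,
      h.duration_eq i hi v,
      hj, if_true]
    congr 1
    funext p
    by_cases hp : p < N.deg v
    · rw [inbox_toProtocol _ v p hp (h.output_eq_none i hi _)]
      simp only [hp, dif_pos]
      rw [add_mul, one_mul, List.take_add]
    · simp [hp, Protocol.inbox]

theorem config_sum (i : ℕ) (hi : i ≤ I) :
    A.toProtocol.config N ω (∑ j ∈ range i, D j) =
      fun v => ⟨N.deg v, A.trajectory N ω i v, 0, fun _ => []⟩ := by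
  induction i with
  | zero => rfl
  | succ i ih =>
    have hD := h.duration_pos i hi
    have hc := h.config_add hi (ih (by omega)) (D i - 1) (by omega)
    funext v
    have e : ∑ j ∈ range (i + 1), D j = ∑ j ∈ range i, D j + (D i - 1) + 1 := by
      rw [sum_range_succ]; omega
    rw [e, Protocol.config]
    simp only [hc]
    have hlt : ¬ D i - 1 + 1 < D i := by omega
    simp only [h.output_eq_none i hi v, Option.isSome_none, Bool.false_eq_true, if_false,
      h.duration_eq i hi v,
      hlt, trajectory]
    congr 2
    refine image_port v _ _ fun p hp => ?_
    rw [inbox_toProtocol _ v p hp (h.output_eq_none i hi _)]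
    simp only [hp, dif_pos]
    -- The last block completes the code, since `D i` blocks of the sender's width cover its whole
    -- length.
    rw [← List.take_add, List.take_of_length_le, decode_encode]
    refine (h.length_le i hi _).trans (le_of_eq ?_)
    obtain ⟨m, hm⟩ : ∃ m, D i = m + 1 := ⟨D i - 1, by omega⟩
    rw [hm, Nat.add_sub_cancel, add_mul, one_mul]

theorem result_eq (v : V) : A.toProtocol.result N ω (∑ j ∈ range I, D j) v =
    A.output (A.trajectory N ω I v) := by
  rw [Protocol.result, h.config_sum I le_rfl]

theorem length_message_le {b : ℝ}
    (hb : ∀ i < I, ∀ v, (A.width (A.trajectory N ω i v) : ℝ) ≤ b) (hb0 : 0 ≤ b)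
    (t : ℕ) (v : V) (p : ℕ) :
    ((A.toProtocol.message (A.toProtocol.config N ω t v) p).length : ℝ) ≤ b := by
  by_cases ht : t < ∑ j ∈ range I, D j
  · obtain ⟨i, hi, j, hj, rfl⟩ : ∃ i < I, ∃ j < D i, t = ∑ j ∈ range i, D j + j := by
      clear hb h
      induction I with
      | zero => simp at ht
      | succ I ih =>
        by_cases h' : t < ∑ j ∈ range I, D j
        · obtain ⟨i, hi, r⟩ := ih h'
          exact ⟨i, by omega, r⟩
        · rw [sum_range_succ] at ht
          exact ⟨I, by omega, t - ∑ j ∈ range I, D j, by omega, by omega⟩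
    rw [h.config_add hi (h.config_sum i hi.le) j hj]
    refine le_trans ?_ (hb i hi v)
    rw [Protocol.message]
    split_ifs
    · simp
    · exact_mod_cast List.length_take_le _ _
  -- After the last broadcast the state is frozen, and terminated vertices are silent.
  · have key : ∀ s, A.toProtocol.config N ω (∑ j ∈ range I, D j + s) v =
        A.toProtocol.config N ω (∑ j ∈ range I, D j) v := by
      intro s
      have ho : (A.toProtocol.output (A.toProtocol.config N ω (∑ j ∈ range I, D j) v)).isSome := by
        rw [h.config_sum I le_rfl]
        exact h.halts v
      induction s with
      | zero => rfl
      | succ s ih =>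
        rw [← add_assoc, Protocol.config]
        simp only [ih, ho, if_true]
    have hs := key (t - ∑ j ∈ range I, D j)
    rw [Nat.add_sub_cancel' (not_lt.mp ht)] at hs
    rw [hs, Protocol.message, if_pos]
    · simpa using hb0
    · rw [h.config_sum I le_rfl]
      exact h.halts v

end Lockstep

end BroadcastAlgorithm

end

/-! ### Distances, spreading of maxima and alarms, and pipelined flooding. -/

section

variable {V : Type} {G : SimpleGraph V}

/-! ### Distances -/

theorem dist_le_succ_iff (hG : G.Connected) {v u : V} {i : ℕ} :
    G.dist v u ≤ i + 1 ↔ u = v ∨ ∃ w, G.Adj v w ∧ G.dist w u ≤ i := by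
  constructor
  · intro h
    obtain ⟨p, hp⟩ := hG.exists_walk_length_eq_dist v u
    cases p with
    | nil => exact Or.inl rfl
    | cons hadj q =>
      refine Or.inr ⟨_, hadj, (SimpleGraph.dist_le q).trans ?_⟩
      rw [SimpleGraph.Walk.length_cons] at hp
      omega
  · rintro (rfl | ⟨w, hw, h⟩)
    · simp
    · have := hG.dist_triangle (u := v) (v := w) (w := u)
      rw [SimpleGraph.dist_eq_one_iff_adj.mpr hw] at this
      omega

/-- A ball that does not grow is closed under adjacency, hence is everything by connectedness. -/
theorem forall_dist_le_of_ball_closed (hG : G.Connected) {v : V} {r : ℕ}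
    (h : ∀ u, G.dist v u ≤ r + 1 → G.dist v u ≤ r) (u : V) : G.dist v u ≤ r := by
  obtain ⟨p⟩ := hG.preconnected u v
  induction p with
  | nil => simp
  | @cons a b c hadj q ih =>
    refine h _ ?_
    have := hG.dist_triangle (u := c) (v := b) (w := a)
    rw [SimpleGraph.dist_eq_one_iff_adj.mpr hadj.symm] at this
    have := ih h
    omega

/-- A geodesic of length above `2 * k` contains `k + 1` disjoint edges, joining its positions `2 *
i` and `2 * i + 1`, and each needs a cover vertex of its own. -/
theorem dist_le_two_mul_of_isVertexCover [Finite V] (hG : G.Connected) {S : Set V} {k : ℕ}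
    (hS : G.IsVertexCover S) (hk : S.ncard ≤ k) (u v : V) : G.dist u v ≤ 2 * k := by
  by_contra! hlt
  obtain ⟨p, hp⟩ := hG.exists_walk_length_eq_dist u v
  have hpath : p.IsPath := p.isPath_of_length_eq_dist hp
  have hcov : ∀ i : Fin (k + 1), ∃ j, (j = 2 * i.1 ∨ j = 2 * i.1 + 1) ∧ p.getVert j ∈ S := by
    intro i
    have hadj := p.adj_getVert_succ (i := 2 * i.1) (by omega)
    rcases hS hadj with h | h
    · exact ⟨_, Or.inl rfl, h⟩
    · exact ⟨_, Or.inr rfl, h⟩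
  choose f hf hfS using hcov
  have hinj : Function.Injective fun i => (⟨p.getVert (f i), hfS i⟩ : S) := by
    intro i j hij
    have h1 := hpath.getVert_injOn (by have := hf i; simp; omega) (by have := hf j; simp; omega)
      (Subtype.ext_iff.mp hij)
    have := hf i
    have := hf j
    ext
    omega
  have := Nat.card_le_card_of_injective _ hinj
  rw [Nat.card_coe_set_eq, Nat.card_fin] at this
  omega

/-! ### Spreading maxima and alarms -/

/-- The maximum of `x` over the ball of radius `i`, computed by `i` exchanges with neighbours. -/
def spreadMax [Fintype V] (G : SimpleGraph V) (x : V → ℕ) : ℕ → V → ℕ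
  | 0 => x
  | i + 1 => fun v => max (spreadMax G x i v) ((G.neighborFinset v).sup (spreadMax G x i))

theorem le_spreadMax [Fintype V] (hG : G.Connected) (x : V → ℕ) {i : ℕ} {v u : V}
    (h : G.dist v u ≤ i) : x u ≤ spreadMax G x i v := by
  induction i generalizing v with
  | zero =>
    rw [Nat.le_zero, hG.dist_eq_zero_iff] at h
    rw [h, spreadMax]
  | succ i ih =>
    rcases (dist_le_succ_iff hG).mp h with rfl | ⟨w, hw, h⟩
    · exact (ih (by simp)).trans (le_max_left _ _)
    · exact (ih h).trans ((le_sup (f := spreadMax G x i) (by simpa using hw)).trans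
        (le_max_right _ _))

theorem exists_eq_spreadMax [Fintype V] (hG : G.Connected) (x : V → ℕ) (i : ℕ) (v : V) :
    ∃ u, G.dist v u ≤ i ∧ spreadMax G x i v = x u := by
  induction i generalizing v with
  | zero => exact ⟨v, by simp, rfl⟩
  | succ i ih =>
    simp only [spreadMax]
    rcases le_total (spreadMax G x i v) ((G.neighborFinset v).sup (spreadMax G x i)) with h | h
    · rw [max_eq_right h]
      rcases (G.neighborFinset v).eq_empty_or_nonempty with h0 | h0
      · rw [h0, sup_empty, bot_eq_zero] at h
        obtain ⟨u, hu, e⟩ := ih v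
        refine ⟨u, by omega, ?_⟩
        rw [h0, sup_empty, bot_eq_zero, ← e]
        omega
      · obtain ⟨w, hw, e⟩ := exists_mem_eq_sup _ h0 (spreadMax G x i)
        obtain ⟨u, hu, e'⟩ := ih w
        refine ⟨u, (dist_le_succ_iff hG).mpr (Or.inr ⟨w, by simpa using hw, hu⟩), ?_⟩
        rw [e, e']
    · rw [max_eq_left h]
      obtain ⟨u, hu, e⟩ := ih v
      exact ⟨u, by omega, e⟩

/-- An alarm that is raised where `a` holds has reached `v` after `i` exchanges. -/
def spreadAlarm (G : SimpleGraph V) (a : V → Prop) : ℕ → V → Prop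
  | 0 => a
  | i + 1 => fun v => spreadAlarm G a i v ∨ ∃ u, G.Adj v u ∧ spreadAlarm G a i u

theorem spreadAlarm_iff (hG : G.Connected) (a : V → Prop) (i : ℕ) (v : V) :
    spreadAlarm G a i v ↔ ∃ u, G.dist v u ≤ i ∧ a u := by
  induction i generalizing v with
  | zero => simp [spreadAlarm, hG.dist_eq_zero_iff]
  | succ i ih =>
    simp only [spreadAlarm, ih, dist_le_succ_iff hG]
    constructor
    · rintro (⟨u, hu, h⟩ | ⟨w, hw, u, hu, h⟩)
      · exact ⟨u, (dist_le_succ_iff hG).mp (by omega), h⟩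
      · exact ⟨u, Or.inr ⟨w, hw, hu⟩, h⟩
    · rintro ⟨u, rfl | ⟨w, hw, hu⟩, h⟩
      · exact Or.inl ⟨u, by simp, h⟩
      · exact Or.inr ⟨w, hw, u, hu, h⟩

/-- Some neighbour holds a different value. -/
def Disagrees (G : SimpleGraph V) (x : V → ℕ) (v : V) : Prop := ∃ u, G.Adj v u ∧ x u ≠ x v

/-- Silence at `v` makes the local maximum constant on the ball of radius `2 * r + 1`. By
injectivity it comes from a single vertex `l`, within `r` of every vertex of this ball; so the ball
has radius at most `2 * r` and is the whole graph. -/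
theorem spreadMax_eq_of_not_spreadAlarm [Fintype V] (hG : G.Connected) {x : V → ℕ}
    (hx : Function.Injective x) {r : ℕ} {v : V}
    (h : ¬ spreadAlarm G (Disagrees G (spreadMax G x r)) (2 * r) v) :
    ∃ l, (∀ u, spreadMax G x r u = x l) ∧ ∀ u, G.dist u l ≤ r := by
  simp only [spreadAlarm_iff hG, Disagrees] at h
  push Not at h
  have hconst : ∀ i ≤ 2 * r + 1, ∀ u, G.dist u v ≤ i → spreadMax G x r u = spreadMax G x r v := by
    intro i hi
    induction i with
    | zero =>
      intro u hu
      rw [Nat.le_zero, hG.dist_eq_zero_iff] at hu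
      rw [hu]
    | succ i ih =>
      intro u hu
      rcases (dist_le_succ_iff hG).mp hu with rfl | ⟨w, hw, hwv⟩
      · rfl
      · rw [← ih (by omega) w hwv]
        exact h w (by rw [SimpleGraph.dist_comm]; omega) u hw.symm
  obtain ⟨l, hl, e⟩ := exists_eq_spreadMax hG x r v
  have hball : ∀ u, G.dist u v ≤ 2 * r + 1 → G.dist u l ≤ r := by
    intro u hu
    obtain ⟨l', hl', e'⟩ := exists_eq_spreadMax hG x r u
    rw [hconst _ le_rfl u hu, e] at e'
    rwa [hx e']
  have hall : ∀ u, G.dist v u ≤ 2 * r := by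
    refine forall_dist_le_of_ball_closed hG fun u hu => ?_
    have h1 := hball u (by rwa [SimpleGraph.dist_comm])
    have h2 := hG.dist_triangle (u := v) (v := l) (w := u)
    rw [SimpleGraph.dist_comm (u := l)] at h2
    omega
  refine ⟨l, fun u => ?_, fun u => hball u ?_⟩
  · rw [← e]
    refine hconst _ le_rfl u ?_
    rw [SimpleGraph.dist_comm]
    exact (hall u).trans (by omega)
  · rw [SimpleGraph.dist_comm]
    exact (hall u).trans (by omega)

theorem not_spreadAlarm_of_forall_dist_le [Fintype V] (hG : G.Connected) {x : V → ℕ} {r i : ℕ}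
    (h : ∀ u v, G.dist u v ≤ r) (v : V) :
    ¬ spreadAlarm G (Disagrees G (spreadMax G x r)) i v := by
  rw [spreadAlarm_iff hG]
  rintro ⟨u, -, w, -, hne⟩
  refine hne ?_
  obtain ⟨a, -, ha⟩ := exists_eq_spreadMax hG x r u
  obtain ⟨b, -, hb⟩ := exists_eq_spreadMax hG x r w
  refine le_antisymm ?_ ?_
  · rw [hb]; exact le_spreadMax hG x (h _ _)
  · rw [ha]; exact le_spreadMax hG x (h _ _)

/-! ### Pipelined flooding -/

/-- At most `q` elements of `s`, and exactly `q` if possible. -/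
def pick (q : ℕ) (s : Finset ℕ) : Finset ℕ :=
  (exists_subset_card_eq (s := s) (n := min q #s) (min_le_right _ _)).choose

theorem pick_subset (q : ℕ) (s : Finset ℕ) : pick q s ⊆ s :=
  (exists_subset_card_eq (s := s) (n := min q #s) (min_le_right _ _)).choose_spec.1

theorem card_pick (q : ℕ) (s : Finset ℕ) : #(pick q s) = min q #s :=
  (exists_subset_card_eq (s := s) (n := min q #s) (min_le_right _ _)).choose_spec.2

/-- The items that a vertex knows and those it has already forwarded, when in every step it
forwards `q` new items to all its neighbours. -/
def flood [Fintype V] (G : SimpleGraph V) (q : ℕ) (own : V → Finset ℕ) :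
    ℕ → V → Finset ℕ × Finset ℕ
  | 0 => fun v => (own v, ∅)
  | t + 1 => fun v =>
      let c := flood G q own t
      ((c v).1 ∪ (G.neighborFinset v).sup (fun u => pick q ((c u).1 \ (c u).2)),
        (c v).2 ∪ pick q ((c v).1 \ (c v).2))

section Flood

variable [Fintype V] {q : ℕ} {own : V → Finset ℕ}

theorem flood_known_subset (t : ℕ) (v : V) :
    (flood G q own t v).1 ⊆ univ.biUnion own := by
  induction t generalizing v with
  | zero => exact subset_biUnion_of_mem own (mem_univ v)
  | succ t ih =>
    refine union_subset (ih v) (Finset.sup_le fun u _ => ?_)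
    exact (pick_subset _ _).trans (sdiff_subset.trans (ih u))

theorem flood_sent_subset (t : ℕ) (v : V) : (flood G q own t v).2 ⊆ (flood G q own t v).1 := by
  induction t generalizing v with
  | zero => exact empty_subset _
  | succ t ih =>
    refine union_subset ((ih v).trans subset_union_left) ?_
    exact (pick_subset _ _).trans (sdiff_subset.trans subset_union_left)

theorem flood_sent_subset_of_adj (t : ℕ) {u v : V} (h : G.Adj v u) :
    (flood G q own t u).2 ⊆ (flood G q own t v).1 := by
  induction t with
  | zero => exact empty_subset _
  | succ t ih =>
    refine union_subset (ih.trans subset_union_left) (Subset.trans ?_ subset_union_right)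
    exact le_sup (f := fun u => pick q ((flood G q own t u).1 \ (flood G q own t u).2))
      (by simpa using h)

theorem own_subset_flood (t : ℕ) (v : V) : own v ⊆ (flood G q own t v).1 := by
  induction t with
  | zero => exact subset_rfl
  | succ t ih => exact ih.trans subset_union_left

/-- Sending lags one step behind knowing: either `q` new items go out, or everything known so far
has been sent after this step and the bound for known items applies. -/
theorem flood_sent_of_known {r : ℕ} {v : V}
    (h : ∀ t, q * (t - r) ≤ #(flood G q own t v).1 ∨
      ∀ u, G.dist v u ≤ r → own u ⊆ (flood G q own t v).1) (t : ℕ) :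
    q * (t - (r + 1)) ≤ #(flood G q own t v).2 ∨
      ∀ u, G.dist v u ≤ r → own u ⊆ (flood G q own t v).2 := by
  induction t with
  | zero => simp
  | succ t ih =>
    set c := flood G q own t with hc
    have e : (flood G q own (t + 1) v).2 = (c v).2 ∪ pick q ((c v).1 \ (c v).2) := rfl
    rw [e]
    rcases le_total q #((c v).1 \ (c v).2) with hq | hq
    · rcases ih with h1 | h1
      · left
        rw [card_union_of_disjoint, card_pick, min_eq_left hq]
        · calc q * (t + 1 - (r + 1)) ≤ q * (t - (r + 1) + 1) := Nat.mul_le_mul_left _ (by omega)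
            _ ≤ _ := by rw [mul_add, mul_one]; omega
        · exact disjoint_sdiff.mono_right (pick_subset _ _)
      · exact Or.inr fun u hu => (h1 u hu).trans subset_union_left
    · have hp : pick q ((c v).1 \ (c v).2) = (c v).1 \ (c v).2 :=
        eq_of_subset_of_card_le (pick_subset _ _) (by rw [card_pick, min_eq_right hq])
      rw [hp, union_sdiff_of_subset (flood_sent_subset t v), Nat.add_sub_add_right]
      exact h t

/-- Induction on the radius. If some neighbour has already sent many items, `v` knows them;
otherwise every neighbour has sent all items of its ball of radius `r`, and these balls together
with `v` make up the ball of radius `r + 1`. -/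
theorem flood_known (hG : G.Connected) (r t : ℕ) (v : V) :
    q * (t - r) ≤ #(flood G q own t v).1 ∨
      ∀ u, G.dist v u ≤ r → own u ⊆ (flood G q own t v).1 := by
  induction r generalizing t v with
  | zero =>
    right
    intro u hu
    rw [Nat.le_zero, hG.dist_eq_zero_iff] at hu
    rw [← hu]
    exact own_subset_flood t v
  | succ r ih =>
    have hs := fun w => flood_sent_of_known (fun t => ih t w) t
    by_cases hex : ∃ w, G.Adj v w ∧ q * (t - (r + 1)) ≤ #(flood G q own t w).2
    · obtain ⟨w, hw, h⟩ := hex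
      exact Or.inl (h.trans (card_le_card (flood_sent_subset_of_adj t hw)))
    · push Not at hex
      right
      intro u hu
      rcases (dist_le_succ_iff hG).mp hu with rfl | ⟨w, hw, hwu⟩
      · exact own_subset_flood t _
      · exact ((hs w).resolve_left (not_le.mpr (hex w hw)) u hwu).trans
          (flood_sent_subset_of_adj t hw)

/-- Flooding delivers everything, or at least more than `q * (t - r)` items, to everyone. -/
theorem flood_eq_or_card_le (hG : G.Connected) {r : ℕ} (hr : ∀ u v, G.dist u v ≤ r) (t : ℕ)
    (v : V) : q * (t - r) ≤ #(flood G q own t v).1 ∨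
      (flood G q own t v).1 = univ.biUnion own := by
  refine (flood_known hG r t v).imp_right fun h => (flood_known_subset t v).antisymm ?_
  exact biUnion_subset.mpr fun u _ => h u (hr v u)

end Flood

end

/-! ### The kernel, its certificates, and the local decision. -/

section

/-- Every pair in `F` has a component in `S`. -/
def CoversPairs {α : Type} (F : Finset (α × α)) (S : Finset α) : Prop :=
  ∀ p ∈ F, p.1 ∈ S ∨ p.2 ∈ S

variable {V : Type} [Fintype V] (G : SimpleGraph V) (k : ℕ)

/-- The kernel of the vertex cover problem: a loop for every vertex of degree more than `k`,
and both orientations of every edge between two other vertices. -/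
def kernelPairs : Finset (V × V) :=
  univ.filter fun p => (p.1 = p.2 ∧ k < G.degree p.1) ∨
    (G.Adj p.1 p.2 ∧ G.degree p.1 ≤ k ∧ G.degree p.2 ≤ k)

variable {G k}

theorem mem_kernelPairs {u v : V} : (u, v) ∈ kernelPairs G k ↔ (u = v ∧ k < G.degree u) ∨
    (G.Adj u v ∧ G.degree u ≤ k ∧ G.degree v ≤ k) := by
  simp [kernelPairs]

theorem kernelPairs_symm {u v : V} (h : (u, v) ∈ kernelPairs G k) : (v, u) ∈ kernelPairs G k := by
  rw [mem_kernelPairs] at *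
  rcases h with ⟨rfl, h⟩ | ⟨h1, h2, h3⟩
  · exact Or.inl ⟨rfl, h⟩
  · exact Or.inr ⟨h1.symm, h3, h2⟩

theorem isVertexCover_of_coversPairs {X : Finset V} (h : CoversPairs (kernelPairs G k) X) :
    G.IsVertexCover X := by
  intro u v huv
  by_cases hu : k < G.degree u
  · exact Or.inl ((h (u, u) (mem_kernelPairs.mpr (Or.inl ⟨rfl, hu⟩))).elim id id)
  by_cases hv : k < G.degree v
  · exact Or.inr ((h (v, v) (mem_kernelPairs.mpr (Or.inl ⟨rfl, hv⟩))).elim id id)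
  exact h (u, v) (mem_kernelPairs.mpr (Or.inr ⟨huv, not_lt.mp hu, not_lt.mp hv⟩))

/-- A cover that misses a vertex contains all its neighbours, which are too many if the degree
exceeds `k`. -/
theorem coversPairs_of_isVertexCover {X : Finset V} (h : G.IsVertexCover X) (hX : #X ≤ k) :
    CoversPairs (kernelPairs G k) X := by
  rintro ⟨u, v⟩ hp
  rcases mem_kernelPairs.mp hp with ⟨rfl, hu⟩ | ⟨huv, -⟩
  · refine Or.inl ?_
    by_contra hX'
    have : G.neighborFinset u ⊆ X := fun w hw =>
      (h ((G.mem_neighborFinset u w).mp hw)).resolve_left hX'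
    have := card_le_card this
    rw [SimpleGraph.card_neighborFinset_eq_degree] at this
    omega
  · exact h huv

/-- A vertex of high degree meets only its loop; any other meets at most `k` edges, each in two
orientations. It is stated for parts `F` of the kernel so that it also applies to certificates. -/
theorem card_le_of_coversPairs (hk : 1 ≤ k) {F : Finset (V × V)} (hF : F ⊆ kernelPairs G k)
    {X : Finset V} (h : CoversPairs F X) (hX : #X ≤ k) : #F ≤ 2 * k ^ 2 := by
  have hsub : F ⊆ X.biUnion fun x => F.filter fun p => p.1 = x ∨ p.2 = x := by
    intro p hp
    rw [mem_biUnion]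
    rcases h p hp with h | h
    · exact ⟨_, h, mem_filter.mpr ⟨hp, Or.inl rfl⟩⟩
    · exact ⟨_, h, mem_filter.mpr ⟨hp, Or.inr rfl⟩⟩
  have hx : ∀ x ∈ X, #(F.filter fun p => p.1 = x ∨ p.2 = x) ≤ 2 * k := by
    intro x _
    by_cases hd : k < G.degree x
    · refine (card_le_card (t := {(x, x)}) ?_).trans (by rw [card_singleton]; omega)
      rintro ⟨u, v⟩ hp
      obtain ⟨hp, hx⟩ := mem_filter.mp hp
      rw [mem_singleton]
      rcases mem_kernelPairs.mp (hF hp) with ⟨rfl, -⟩ | ⟨-, hu, hv⟩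
      · rcases hx with rfl | rfl <;> rfl
      · rcases hx with rfl | rfl
        · exact absurd hd (not_lt.mpr hu)
        · exact absurd hd (not_lt.mpr hv)
    · refine (card_le_card (t := (G.neighborFinset x).image (fun y => (x, y)) ∪
        (G.neighborFinset x).image (fun y => (y, x))) ?_).trans ?_
      · rintro ⟨u, v⟩ hp
        obtain ⟨hp, hx⟩ := mem_filter.mp hp
        rcases mem_kernelPairs.mp (hF hp) with ⟨rfl, hu⟩ | ⟨huv, -⟩
        · rcases hx with rfl | rfl <;> exact absurd hu hd
        · rcases hx with rfl | rfl
          · simpa using huv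
          · simpa using huv.symm
      · refine (card_union_le _ _).trans ?_
        have h1 := card_image_le (s := G.neighborFinset x) (f := fun y => (x, y))
        have h2 := card_image_le (s := G.neighborFinset x) (f := fun y => (y, x))
        rw [SimpleGraph.card_neighborFinset_eq_degree] at h1 h2
        omega
  calc #F ≤ _ := card_le_card hsub
    _ ≤ #X * (2 * k) := card_biUnion_le_card_mul _ _ _ hx
    _ ≤ k * (2 * k) := Nat.mul_le_mul_right _ hX
    _ = _ := by ring

theorem exists_vertexCover_iff : (∃ S : Set V, G.IsVertexCover S ∧ S.ncard ≤ k) ↔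
    ∃ X : Finset V, #X ≤ k ∧ CoversPairs (kernelPairs G k) X := by
  constructor
  · rintro ⟨S, hS, hc⟩
    rw [Set.ncard_eq_toFinset_card'] at hc
    exact ⟨S.toFinset, hc, coversPairs_of_isVertexCover (by simpa using hS) hc⟩
  · rintro ⟨X, hc, hX⟩
    exact ⟨X, isVertexCover_of_coversPairs hX, by rwa [Set.ncard_coe_finset]⟩

variable (G k) in
/-- A part of the kernel that certifies that there is no small vertex cover, if this is the
case, and the whole kernel otherwise. -/
theorem exists_certificate : ∃ F ⊆ kernelPairs G k, #F ≤ 2 * k ^ 2 + 1 ∧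
    (#F ≤ 2 * k ^ 2 → F = kernelPairs G k) ∧
    (#(kernelPairs G k) ≤ 2 * k ^ 2 → F = kernelPairs G k) := by
  by_cases h : #(kernelPairs G k) ≤ 2 * k ^ 2
  · exact ⟨_, subset_rfl, by omega, fun _ => rfl, fun _ => rfl⟩
  · obtain ⟨F, hF, hc⟩ := exists_subset_card_eq (s := kernelPairs G k) (n := 2 * k ^ 2 + 1)
      (by omega)
    exact ⟨F, hF, hc.le, fun h' => by omega, fun h' => absurd h' h⟩

/-- The vertices that occur in `F`. -/
def endpoints (F : Finset (V × V)) : Finset V := F.image Prod.fst ∪ F.image Prod.snd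

omit [Fintype V] in
theorem card_endpoints_le (F : Finset (V × V)) : #(endpoints F) ≤ 2 * #F := by
  have h1 := card_image_le (s := F) (f := Prod.fst)
  have h2 := card_image_le (s := F) (f := Prod.snd)
  have := card_union_le (F.image Prod.fst) (F.image Prod.snd)
  rw [endpoints]
  omega

omit [Fintype V] in
theorem mem_endpoints {F : Finset (V × V)} {p : V × V} (hp : p ∈ F) :
    p.1 ∈ endpoints F ∧ p.2 ∈ endpoints F :=
  ⟨mem_union_left _ (mem_image_of_mem _ hp), mem_union_right _ (mem_image_of_mem _ hp)⟩

/-- The name of a pair of vertices whose labels are given by `label`. -/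
def pairCode (label : V → ℕ) (p : V × V) : ℕ := Nat.pair (label p.1) (label p.2)

/-- A set of labels that meets every pair in `I`. -/
def CoversCodes (I : Finset ℕ) (S : Finset ℕ) : Prop :=
  ∀ x ∈ I, x.unpair.1 ∈ S ∨ x.unpair.2 ∈ S

/-- The decision of a vertex that knows the set `I` of all labelled pairs in the kernel, its own
label and the set `own` of those pairs that begin with itself. -/
def decideVerdict (k : ℕ) (own : Finset ℕ) (label : ℕ) (I : Finset ℕ) : Verdict :=
  if h : #I ≤ 2 * k ^ 2 ∧ ∃ S : Finset ℕ, #S ≤ k ∧ CoversCodes I S then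
    -- The chosen set depends only on `k` and `I`, so all vertices agree on it. Vertices off the
    -- kernel stay outside even if their label collides with a chosen one.
    if own.Nonempty ∧ label ∈ h.2.choose then .inside else .outside
  else .noSolution

variable (G k) in
/-- The labelled pairs in the kernel that begin with `v`. -/
def ownCodes (label : V → ℕ) (v : V) : Finset ℕ :=
  ((kernelPairs G k).filter fun p => p.1 = v).image (pairCode label)

theorem biUnion_ownCodes (label : V → ℕ) :
    univ.biUnion (ownCodes G k label) = (kernelPairs G k).image (pairCode label) := by
  ext x
  simp only [mem_biUnion, mem_univ, true_and, ownCodes, mem_image, mem_filter]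
  constructor
  · rintro ⟨v, p, ⟨hp, -⟩, rfl⟩
    exact ⟨p, hp, rfl⟩
  · rintro ⟨p, hp, rfl⟩
    exact ⟨p.1, p, ⟨hp, rfl⟩, rfl⟩

theorem ownCodes_nonempty {label : V → ℕ} {v : V} :
    (ownCodes G k label v).Nonempty ↔ ∃ p ∈ kernelPairs G k, p.1 = v := by
  simp [ownCodes, Finset.Nonempty]

/-- If a small cover exists, `F` is the whole kernel, labels are faithful on it, and covers transfer
both ways. If none exists, a small label cover would pull back to at most `k` endpoints covering
`F`; then `F` is too small to be a mere part, so the kernel itself would be covered. Collisions away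
from `F` do no harm. -/
theorem solvesVertexCover_decideVerdict (hk : 1 ≤ k) {F : Finset (V × V)}
    (hF : F ⊆ kernelPairs G k) (hF1 : #F ≤ 2 * k ^ 2 → F = kernelPairs G k)
    (hF2 : #(kernelPairs G k) ≤ 2 * k ^ 2 → F = kernelPairs G k)
    {label : V → ℕ} (hlabel : Set.InjOn label (endpoints F)) :
    SolvesVertexCover G k fun v => some (decideVerdict k (ownCodes G k label v) (label v)
      ((kernelPairs G k).image (pairCode label))) := by
  set I := (kernelPairs G k).image (pairCode label) with hI
  constructor
  · rw [exists_vertexCover_iff]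
    rintro ⟨X, hXc, hX⟩
    have hcard := card_le_of_coversPairs hk subset_rfl hX hXc
    obtain rfl := hF2 hcard
    have hex : #I ≤ 2 * k ^ 2 ∧ ∃ S : Finset ℕ, #S ≤ k ∧ CoversCodes I S := by
      refine ⟨card_image_le.trans hcard, X.image label, card_image_le.trans hXc, ?_⟩
      intro x hx
      obtain ⟨p, hp, rfl⟩ := mem_image.mp hx
      simp only [pairCode, Nat.unpair_pair]
      exact (hX p hp).imp (mem_image_of_mem _) (mem_image_of_mem _)
    set S := hex.2.choose with hSdef
    have hS : #S ≤ k ∧ CoversCodes I S := hex.2.choose_spec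
    have hdec : ∀ v, decideVerdict k (ownCodes G k label v) (label v) I =
        if (ownCodes G k label v).Nonempty ∧ label v ∈ S then .inside else .outside := by
      intro v
      rw [decideVerdict, dif_pos hex]
    set Y := univ.filter fun v => (ownCodes G k label v).Nonempty ∧ label v ∈ S with hY
    have hset : {v | (some (decideVerdict k (ownCodes G k label v) (label v) I)) =
        some Verdict.inside} = (Y : Set V) := by
      ext v
      simp only [hdec, Set.mem_ofPred_eq, hY, coe_filter, mem_univ, true_and]
      split_ifs with h <;> simp [h]
    rw [hset]
    refine ⟨fun v => ?_, isVertexCover_of_coversPairs (k := k) ?_, ?_⟩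
    · simp only [hdec]
      split_ifs <;> simp
    · rintro ⟨u, v⟩ hp
      have hu : (ownCodes G k label u).Nonempty := ownCodes_nonempty.mpr ⟨_, hp, rfl⟩
      have hv : (ownCodes G k label v).Nonempty :=
        ownCodes_nonempty.mpr ⟨_, kernelPairs_symm hp, rfl⟩
      have := hS.2 _ (mem_image_of_mem (pairCode label) hp)
      simp only [pairCode, Nat.unpair_pair] at this
      simpa [hY, hu, hv] using this
    · rw [Set.ncard_coe_finset]
      refine le_trans (card_le_card_of_injOn label (fun v hv => ?_) (hlabel.mono ?_)) hS.1
      · exact (mem_filter.mp hv).2.2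
      · intro v hv
        obtain ⟨p, hp, rfl⟩ := ownCodes_nonempty.mp (mem_filter.mp hv).2.1
        exact (mem_endpoints hp).1
  · intro hno v
    rw [exists_vertexCover_iff] at hno
    refine congrArg some (dif_neg ?_)
    rintro ⟨-, S, hS, hcov⟩
    have hYc : #((endpoints F).filter fun v => label v ∈ S) ≤ k :=
      (card_le_card_of_injOn label (fun v hv => (mem_filter.mp hv).2)
        (hlabel.mono fun v hv => (mem_filter.mp hv).1)).trans hS
    have hY : CoversPairs F ((endpoints F).filter fun v => label v ∈ S) := by
      intro p hp
      have := hcov _ (mem_image_of_mem (pairCode label) (hF hp))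
      simp only [pairCode, Nat.unpair_pair] at this
      simpa [mem_endpoints hp] using this
    have := hF1 (card_le_of_coversPairs hk hF hY hYc)
    exact hno ⟨_, hYc, this ▸ hY⟩

end

/-! ### The algorithm and its states stage by stage. -/

section

/-- What a vertex is doing. First the maximal identifier `m` in a ball is determined, then an
alarm is spread if these maxima differ somewhere, then neighbours exchange labels, and finally the
labelled kernel is flooded. -/
inductive Stage
  | elect (i m : ℕ)
  | warn (i m : ℕ) (alarm : Prop)
  | greet (m : ℕ)
  | flood (i m : ℕ) (own known sent : Finset ℕ)
  | halt (v : Verdict)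

/-- The state of a vertex. -/
structure LocalState where
  degree : ℕ
  label : ℕ
  stage : Stage

/-- The number of bits of a label, if `m` is the maximal identifier. -/
def labelBits (k e m : ℕ) : ℕ := if k ≤ 1 then m.size else e * k.size

/-- The number of bits of the code of a pair of labels. -/
def itemBits (k e m : ℕ) : ℕ := 4 * labelBits k e m + 1

/-- The number of communication rounds per broadcast. -/
def roundsPerBroadcast (k e m : ℕ) : ℕ := itemBits k e m / m.size + 1

/-- The number of items per broadcast. -/
def itemsPerBroadcast (k e m : ℕ) : ℕ := m.size / itemBits k e m + 1

/-- The number of broadcasts that are used for flooding. -/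
def floodLength (k e m : ℕ) : ℕ := 4 * k + 2 * k ^ 2 / itemsPerBroadcast k e m + 1

/-- The label of a vertex is random, unless `k` is at most one. -/
def vertexLabel (k e ident : ℕ) (coins : Fin (e * k.size) → Bool) : ℕ :=
  -- No lower bound on `δ 1` is given, so `k = 1` must succeed with certainty; identifiers are
  -- affordable there.
  if k ≤ 1 then ident else Fintype.equivFin _ coins

theorem vertexLabel_lt {k e m ident : ℕ} (h : ident ≤ m) (coins : Fin (e * k.size) → Bool) :
    vertexLabel k e ident coins < 2 ^ labelBits k e m := by
  rw [vertexLabel, labelBits]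
  split_ifs
  · exact h.trans_lt (Nat.lt_size_self m)
  · refine (Fin.is_lt _).trans_le ?_
    simp

/-- The batch of items fits into one broadcast: `q` items take at most `m.size + itemBits` bits, and
each summand is at most the number of rounds times `m.size`. -/
theorem itemsPerBroadcast_mul_le (k e : ℕ) {m : ℕ} (hm : 0 < m.size) :
    itemsPerBroadcast k e m * itemBits k e m ≤ roundsPerBroadcast k e m * (2 * m.size) := by
  have h1 : itemsPerBroadcast k e m * itemBits k e m ≤ m.size + itemBits k e m := by
    rw [itemsPerBroadcast, add_mul, one_mul]
    exact Nat.add_le_add_right (Nat.div_mul_le_self _ _) _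
  have h2 : itemBits k e m < roundsPerBroadcast k e m * m.size := by
    rw [roundsPerBroadcast, mul_comm]
    exact Nat.lt_mul_div_succ _ hm
  have h3 : 1 * m.size ≤ roundsPerBroadcast k e m * m.size :=
    Nat.mul_le_mul_right _ (Nat.le_add_left 1 _)
  calc _ ≤ m.size + itemBits k e m := h1
    _ ≤ roundsPerBroadcast k e m * m.size + roundsPerBroadcast k e m * m.size := by omega
    _ = _ := by ring

/-- The set that a vertex broadcasts. -/
def LocalState.message (k e : ℕ) : LocalState → Finset ℕ
  | ⟨_, _, .elect _ m⟩ => {m}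
  | ⟨_, _, .warn _ _ alarm⟩ => if alarm then {0} else ∅
  -- Vertices of high degree are silent, so a vertex hears the labels of its neighbours of low
  -- degree only.
  | ⟨d, l, .greet _⟩ => if k < d then ∅ else {l}
  | ⟨_, _, .flood _ m _ known sent⟩ => pick (itemsPerBroadcast k e m) (known \ sent)
  | ⟨_, _, .halt _⟩ => ∅

/-- The new stage of a vertex with degree `d` and label `l` that has received `rec`. -/
def nextStage (k e d l : ℕ) (rec : Finset (Finset ℕ)) : Stage → Stage
  | .elect i m =>
      if i < 2 * k then .elect (i + 1) (max m (rec.sup fun s => s.sup id))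
      -- The last broadcast of the election only compares values, so this stage takes `2 * k + 1`
      -- broadcasts.
      else .warn 0 m (∃ s ∈ rec, s ≠ {m})
  | .warn i m alarm =>
      if i + 1 < 2 * (2 * k) then .warn (i + 1) m (alarm ∨ {0} ∈ rec)
      else if alarm ∨ {0} ∈ rec then .halt .noSolution else .greet m
  | .greet m =>
      let own := if k < d then {Nat.pair l l} else (rec.sup id).image (Nat.pair l)
      .flood 0 m own own ∅
  | .flood i m own known sent =>
      if i + 1 < floodLength k e m then
        .flood (i + 1) m own (known ∪ rec.sup id)
          (sent ∪ pick (itemsPerBroadcast k e m) (known \ sent))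
      else .halt (decideVerdict k own l (known ∪ rec.sup id))
  | .halt v => .halt v

/-- The algorithm for vertex covers of size `k`, with random labels of `e * k.size` bits. -/
def coverAlgorithm (k e : ℕ) : BroadcastAlgorithm where
  numCoins := e * k.size
  State := LocalState
  init i d ω := ⟨d, vertexLabel k e i ω, if k = 0 then .halt .noSolution else .elect 0 i⟩
  message s := s.message k e
  update s rec := ⟨s.degree, s.label, nextStage k e s.degree s.label rec s.stage⟩
  duration s := match s.stage with
    | .greet m => roundsPerBroadcast k e m
    | .flood _ m _ _ _ => roundsPerBroadcast k e m
    | _ => 1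
  width s := match s.stage with
    | .greet m => 2 * m.size
    | .flood _ m _ _ _ => 2 * m.size
    | _ => (encode (s.message k e)).length
  output s := match s.stage with
    | .halt v => some v
    | _ => none

variable {V : Type} [Fintype V] (N : Network V) (k e : ℕ) (ω : V → Fin (e * k.size) → Bool)

theorem Network.deg_eq_degree (v : V) : N.deg v = N.graph.degree v := by
  rw [Network.deg, Nat.card_eq_fintype_card, SimpleGraph.card_neighborSet_eq_degree]

/-- The label of a vertex in the network. -/
def networkLabel (v : V) : ℕ := vertexLabel k e (N.ident v) (ω v)

/-- The state of a vertex of the network in a given stage. -/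
def inStage (v : V) (s : Stage) : LocalState := ⟨N.deg v, networkLabel N k e ω v, s⟩

/-- The alarm at `v` after `i` exchanges. -/
def networkAlarm (i : ℕ) (v : V) : Prop :=
  spreadAlarm N.graph (Disagrees N.graph (spreadMax N.graph N.ident (2 * k))) i v

variable {N k e ω}

theorem trajectory_succ_of_stages {i : ℕ} {σ : V → Stage}
    (h : ∀ v, (coverAlgorithm k e).trajectory N ω i v = inStage N k e ω v (σ v)) (v : V) :
    (coverAlgorithm k e).trajectory N ω (i + 1) v = inStage N k e ω v
      (nextStage k e (N.deg v) (networkLabel N k e ω v)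
        ((N.graph.neighborFinset v).image fun u => (inStage N k e ω u (σ u)).message k e) (σ v)) := by
  simp only [BroadcastAlgorithm.trajectory, h]
  rfl

theorem trajectory_elect (hk : 1 ≤ k) {i : ℕ} (hi : i ≤ 2 * k) (v : V) :
    (coverAlgorithm k e).trajectory N ω i v =
      inStage N k e ω v (.elect i (spreadMax N.graph N.ident i v)) := by
  induction i generalizing v with
  | zero =>
    have : k ≠ 0 := by omega
    simp only [BroadcastAlgorithm.trajectory, coverAlgorithm, this, if_false]
    rfl
  | succ i ih =>
    rw [trajectory_succ_of_stages (ih (by omega)) v]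
    have : i < 2 * k := hi
    simp only [nextStage, this, if_true, inStage, LocalState.message, sup_image, Function.comp_def,
      sup_singleton, id_eq, spreadMax]
    rfl

theorem networkAlarm_succ (i : ℕ) (v : V) : networkAlarm N k (i + 1) v ↔
    networkAlarm N k i v ∨ ∃ u, N.graph.Adj v u ∧ networkAlarm N k i u := Iff.rfl

theorem trajectory_warn (hk : 1 ≤ k) {j : ℕ} (hj : j < 2 * (2 * k)) (v : V) :
    (coverAlgorithm k e).trajectory N ω (2 * k + 1 + j) v = inStage N k e ω v
      (.warn j (spreadMax N.graph N.ident (2 * k) v) (networkAlarm N k j v)) := by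
  induction j generalizing v with
  | zero =>
    rw [add_zero, trajectory_succ_of_stages (trajectory_elect hk le_rfl) v]
    simp only [nextStage, lt_irrefl, if_false, inStage, LocalState.message]
    congr 2
    simp [networkAlarm, spreadAlarm, Disagrees]
  | succ j ih =>
    rw [← add_assoc, trajectory_succ_of_stages (ih (by omega)) v]
    simp only [nextStage, hj, if_true, inStage, LocalState.message]
    congr 2
    simp [networkAlarm_succ]

theorem trajectory_after_warn (hk : 1 ≤ k) (v : V) :
    (coverAlgorithm k e).trajectory N ω (6 * k + 1) v = inStage N k e ω v
      (if networkAlarm N k (2 * (2 * k)) v then .halt .noSolution else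
        .greet (spreadMax N.graph N.ident (2 * k) v)) := by
  have e1 : 6 * k + 1 = 2 * k + 1 + (2 * (2 * k) - 1) + 1 := by omega
  rw [e1, trajectory_succ_of_stages (trajectory_warn hk (by omega)) v]
  have e2 : ¬ 2 * (2 * k) - 1 + 1 < 2 * (2 * k) := by omega
  have e3 : 2 * (2 * k) = 2 * (2 * k) - 1 + 1 := by omega
  simp only [nextStage, e2, if_false, inStage, LocalState.message]
  congr 2
  rw [e3]
  simp [networkAlarm_succ]

/-- One exchange of labels suffices for a vertex to find the kernel pairs that begin with it. -/
theorem greet_own_eq (v : V) :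
    (if k < N.deg v then {Nat.pair (networkLabel N k e ω v) (networkLabel N k e ω v)} else
      (((N.graph.neighborFinset v).image fun u =>
        if k < N.deg u then (∅ : Finset ℕ) else {networkLabel N k e ω u}).sup id).image
          (Nat.pair (networkLabel N k e ω v))) =
      ownCodes N.graph k (networkLabel N k e ω) v := by
  ext x
  simp only [ownCodes, N.deg_eq_degree, mem_image, mem_filter, Prod.exists, mem_kernelPairs,
    pairCode]
  split_ifs with h
  · constructor
    · intro hx
      exact ⟨v, v, ⟨Or.inl ⟨rfl, h⟩, rfl⟩, (mem_singleton.mp hx).symm⟩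
    · rintro ⟨a, b, ⟨⟨rfl, -⟩ | ⟨-, ha, -⟩, rfl⟩, rfl⟩
      · exact mem_singleton_self _
      · omega
  · simp only [mem_image, mem_sup, id_eq]
    constructor
    · rintro ⟨y, ⟨_, ⟨u, hu, rfl⟩, hy⟩, rfl⟩
      split_ifs at hy with h'
      · simp at hy
      · rw [mem_singleton] at hy
        rw [hy]
        exact ⟨v, u, ⟨Or.inr ⟨by simpa using hu, not_lt.mp h, not_lt.mp h'⟩, rfl⟩, rfl⟩
    · rintro ⟨a, b, ⟨⟨rfl, h'⟩ | ⟨hab, ha, hb⟩, rfl⟩, rfl⟩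
      · exact absurd h' h
      · refine ⟨_, ⟨_, ⟨b, by simpa using hab, rfl⟩, ?_⟩, rfl⟩
        rw [if_neg (not_lt.mpr hb)]
        exact mem_singleton_self _

section NoAlarm

variable (hk : 1 ≤ k) (halarm : ∀ v, ¬ networkAlarm N k (2 * (2 * k)) v) {m : ℕ}
  (hm : ∀ v, spreadMax N.graph N.ident (2 * k) v = m)
include hk halarm hm

theorem trajectory_greet (v : V) :
    (coverAlgorithm k e).trajectory N ω (6 * k + 1) v = inStage N k e ω v (.greet m) := by
  rw [trajectory_after_warn hk, if_neg (halarm v), hm]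

theorem trajectory_flood {t : ℕ} (ht : t < floodLength k e m) (v : V) :
    (coverAlgorithm k e).trajectory N ω (6 * k + 2 + t) v = inStage N k e ω v
      (.flood t m (ownCodes N.graph k (networkLabel N k e ω) v)
        (flood N.graph (itemsPerBroadcast k e m)
          (ownCodes N.graph k (networkLabel N k e ω)) t v).1
        (flood N.graph (itemsPerBroadcast k e m)
          (ownCodes N.graph k (networkLabel N k e ω)) t v).2) := by
  induction t generalizing v with
  | zero =>
    rw [add_zero, trajectory_succ_of_stages (trajectory_greet hk halarm hm) v]
    simp only [nextStage, inStage, LocalState.message, flood, ← greet_own_eq]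
    rfl
  | succ t ih =>
    rw [← add_assoc, trajectory_succ_of_stages (ih (by omega)) v]
    simp only [nextStage, ht, if_true, inStage, LocalState.message, sup_image, flood,
      Function.comp_def, id_eq]
    rfl

theorem trajectory_halt (v : V) :
    (coverAlgorithm k e).trajectory N ω (6 * k + 2 + floodLength k e m) v = inStage N k e ω v
      (.halt (decideVerdict k (ownCodes N.graph k (networkLabel N k e ω) v)
        (networkLabel N k e ω v) (flood N.graph (itemsPerBroadcast k e m)
          (ownCodes N.graph k (networkLabel N k e ω)) (floodLength k e m) v).1)) := by
  obtain ⟨t, ht⟩ : ∃ t, floodLength k e m = t + 1 := ⟨_, rfl⟩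
  rw [ht, ← add_assoc, trajectory_succ_of_stages
    (trajectory_flood hk halarm hm (by omega)) v]
  simp only [nextStage, ht, lt_irrefl, if_false, inStage, LocalState.message, sup_image, flood,
    Function.comp_def, id_eq]
  rfl

end NoAlarm

end

/-! ### Synchronization, message sizes and running time. -/

section

variable {V : Type} [Fintype V] {N : Network V} {k e : ℕ} {ω : V → Fin (e * k.size) → Bool}

/-! ### Lockstep -/

theorem trajectory_before_greet (hk : 1 ≤ k) {i : ℕ} (hi : i < 6 * k + 1) (v : V) :
    (coverAlgorithm k e).output ((coverAlgorithm k e).trajectory N ω i v) = none ∧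
    (coverAlgorithm k e).duration ((coverAlgorithm k e).trajectory N ω i v) = 1 ∧
    (coverAlgorithm k e).width ((coverAlgorithm k e).trajectory N ω i v) =
      (encode ((coverAlgorithm k e).message ((coverAlgorithm k e).trajectory N ω i v))).length ∧
    ∃ u, (coverAlgorithm k e).width ((coverAlgorithm k e).trajectory N ω i v) ≤
      2 * (N.ident u).size + 1 := by
  rcases Nat.lt_or_ge i (2 * k + 1) with h | h
  · rw [trajectory_elect hk (by omega)]
    refine ⟨rfl, rfl, rfl, ?_⟩
    obtain ⟨u, -, hu⟩ := exists_eq_spreadMax N.connected N.ident i v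
    refine ⟨u, ?_⟩
    simp only [coverAlgorithm, inStage, LocalState.message, length_encode, sum_singleton, hu,
      le_refl]
  · obtain ⟨j, rfl⟩ := Nat.exists_eq_add_of_le h
    rw [trajectory_warn hk (by omega)]
    refine ⟨rfl, rfl, rfl, v, ?_⟩
    simp only [coverAlgorithm, inStage, LocalState.message, length_encode]
    split_ifs <;> simp

theorem lockstep_of_networkAlarm (hk : 1 ≤ k) (h : ∀ v, networkAlarm N k (2 * (2 * k)) v) :
    (coverAlgorithm k e).Lockstep N ω (6 * k + 1) fun _ => 1 where
  output_eq_none _ hi v := (trajectory_before_greet hk hi v).1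
  duration_eq _ hi v := (trajectory_before_greet hk hi v).2.1
  duration_pos _ _ := one_pos
  length_le i hi v := by rw [one_mul, (trajectory_before_greet hk hi v).2.2.1]
  halts v := by
    rw [trajectory_after_warn hk, if_pos (h v)]
    rfl

/-- The number of communication rounds of the `i`-th broadcast. -/
def broadcastRounds (k e m i : ℕ) : ℕ := if i < 6 * k + 1 then 1 else roundsPerBroadcast k e m

section NoAlarm

variable (hk : 1 ≤ k) (halarm : ∀ v, ¬ networkAlarm N k (2 * (2 * k)) v) {m : ℕ}
  (hm : ∀ v, spreadMax N.graph N.ident (2 * k) v = m)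
include hk halarm hm

theorem trajectory_from_greet (hident : ∀ v, N.ident v ≤ m) (hpos : 0 < m.size) {i : ℕ}
    (hi : 6 * k + 1 ≤ i) (hi' : i < 6 * k + 2 + floodLength k e m) (v : V) :
    (coverAlgorithm k e).output ((coverAlgorithm k e).trajectory N ω i v) = none ∧
    (coverAlgorithm k e).duration ((coverAlgorithm k e).trajectory N ω i v) =
      roundsPerBroadcast k e m ∧
    (coverAlgorithm k e).width ((coverAlgorithm k e).trajectory N ω i v) = 2 * m.size ∧
    (encode ((coverAlgorithm k e).message ((coverAlgorithm k e).trajectory N ω i v))).length ≤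
      roundsPerBroadcast k e m * (2 * m.size) := by
  have hlab : ∀ v, networkLabel N k e ω v < 2 ^ labelBits k e m := fun v =>
    vertexLabel_lt (hident v) _
  have hb := itemsPerBroadcast_mul_le k e hpos
  have hq : 1 ≤ itemsPerBroadcast k e m := Nat.le_add_left 1 _
  rcases hi.eq_or_lt with rfl | hi
  · rw [trajectory_greet hk halarm hm]
    refine ⟨rfl, rfl, rfl, ?_⟩
    refine (length_encode_le (w := labelBits k e m) (fun x hx => ?_)).trans ((?_ : _ ≤ _).trans hb)
    · simp only [coverAlgorithm, inStage, LocalState.message] at hx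
      split_ifs at hx
      · simp at hx
      · rw [mem_singleton.mp hx]
        exact hlab v
    · refine Nat.mul_le_mul ?_ (by rw [itemBits]; omega)
      refine le_trans ?_ hq
      simp only [coverAlgorithm, inStage, LocalState.message]
      split_ifs <;> simp
  · obtain ⟨t, rfl⟩ : ∃ t, i = 6 * k + 2 + t := ⟨i - (6 * k + 2), by omega⟩
    rw [trajectory_flood hk halarm hm (by omega)]
    refine ⟨rfl, rfl, rfl, ?_⟩
    refine (length_encode_le (w := 2 * labelBits k e m) (fun x hx => ?_)).trans
      ((?_ : _ ≤ _).trans hb)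
    · have hx := flood_known_subset _ _ (sdiff_subset (pick_subset _ _ hx))
      rw [biUnion_ownCodes] at hx
      obtain ⟨p, -, rfl⟩ := mem_image.mp hx
      -- The code of a pair is less than the square of the larger label plus one, hence has at most
      -- twice the bits of a label.
      rw [pairCode, mul_comm 2, pow_mul]
      refine (Nat.pair_lt_max_add_one_sq _ _).trans_le (Nat.pow_le_pow_left ?_ 2)
      exact max_lt (hlab _) (hlab _)
    · refine Nat.mul_le_mul ?_ (by rw [itemBits]; omega)
      simp only [coverAlgorithm, inStage, LocalState.message]
      rw [card_pick]
      exact min_le_left _ _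

theorem lockstep_of_not_networkAlarm (hident : ∀ v, N.ident v ≤ m) (hpos : 0 < m.size) :
    (coverAlgorithm k e).Lockstep N ω (6 * k + 2 + floodLength k e m) (broadcastRounds k e m) where
  output_eq_none i hi v := by
    rcases Nat.lt_or_ge i (6 * k + 1) with h | h
    · exact (trajectory_before_greet hk h v).1
    · exact (trajectory_from_greet hk halarm hm hident hpos h hi v).1
  duration_eq i hi v := by
    rw [broadcastRounds]
    split_ifs with h
    · exact (trajectory_before_greet hk h v).2.1
    · exact (trajectory_from_greet hk halarm hm hident hpos (not_lt.mp h) hi v).2.1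
  duration_pos i _ := by
    rw [broadcastRounds]
    split_ifs
    · exact one_pos
    · exact Nat.succ_pos _
  length_le i hi v := by
    rw [broadcastRounds]
    split_ifs with h
    · rw [one_mul, (trajectory_before_greet hk h v).2.2.1]
    · have := trajectory_from_greet hk halarm hm hident hpos (not_lt.mp h) hi v (ω := ω)
      rw [this.2.2.1]
      exact this.2.2.2
  halts v := by
    rw [trajectory_halt hk halarm hm]
    rfl

theorem output_trajectory_eq (hdist : ∀ u v, N.graph.dist u v ≤ 2 * (2 * k)) (v : V) :
    (coverAlgorithm k e).output
      ((coverAlgorithm k e).trajectory N ω (6 * k + 2 + floodLength k e m) v) =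
      some (decideVerdict k (ownCodes N.graph k (networkLabel N k e ω) v)
        (networkLabel N k e ω v)
        ((kernelPairs N.graph k).image (pairCode (networkLabel N k e ω)))) := by
  rw [trajectory_halt hk halarm hm]
  refine congrArg some ?_
  have hfl := flood_eq_or_card_le (q := itemsPerBroadcast k e m)
    (own := ownCodes N.graph k (networkLabel N k e ω)) N.connected hdist (floodLength k e m) v
  have hsub := flood_known_subset (G := N.graph) (q := itemsPerBroadcast k e m)
    (own := ownCodes N.graph k (networkLabel N k e ω)) (floodLength k e m) v
  rw [biUnion_ownCodes] at hfl hsub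
  rcases hfl with h | h
  -- Flooding was cut off, but with more than `2 * k ^ 2` items known; the full set is larger still,
  -- so both decisions are `noSolution`.
  · have h1 : 2 * k ^ 2 <
        itemsPerBroadcast k e m * (floodLength k e m - 2 * (2 * k)) := by
      have : floodLength k e m - 2 * (2 * k) = 2 * k ^ 2 / itemsPerBroadcast k e m + 1 := by
        rw [floodLength, show 2 * (2 * k) = 4 * k by ring, add_assoc, Nat.add_sub_cancel_left]
      rw [this]
      exact Nat.lt_mul_div_succ _ (Nat.succ_pos _)
    have h2 := card_le_card hsub
    rw [decideVerdict, decideVerdict, dif_neg (by omega), dif_neg (by omega)]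
  · rw [h]

end NoAlarm

/-- The alarm is unanimous, so all vertices take the same branch. In the silent branch two vertices
are joined through `l`, which gives twice the radius `2 * k`. -/
theorem networkAlarm_dichotomy (N : Network V) (k : ℕ) :
    (∀ v, networkAlarm N k (2 * (2 * k)) v) ∨
    (∀ v, ¬ networkAlarm N k (2 * (2 * k)) v) ∧ ∃ l, (∀ v, N.ident v ≤ N.ident l) ∧
      (∀ v, spreadMax N.graph N.ident (2 * k) v = N.ident l) ∧
      ∀ u v, N.graph.dist u v ≤ 2 * (2 * k) := by
  by_cases h : ∀ v, networkAlarm N k (2 * (2 * k)) v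
  · exact Or.inl h
  · push Not at h
    obtain ⟨v, hv⟩ := h
    obtain ⟨l, hl, hd⟩ := spreadMax_eq_of_not_spreadAlarm N.connected N.ident_injective hv
    refine Or.inr ⟨fun u hu => ?_, l, fun u => ?_, hl, fun u w => ?_⟩
    · obtain ⟨a, -, b, -, hne⟩ := (spreadAlarm_iff N.connected _ _ _).mp hu
      exact hne (by rw [hl, hl])
    · rw [← hl u]
      exact le_spreadMax N.connected _ (by simp)
    · have h1 := hd u
      have h2 := hd w
      have h3 := N.connected.dist_triangle (u := u) (v := l) (w := w)
      rw [SimpleGraph.dist_comm (u := l)] at h3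
      omega

theorem not_exists_vertexCover_of_networkAlarm {i : ℕ} {v : V} (h : networkAlarm N k i v) :
    ¬ ∃ S : Set V, N.graph.IsVertexCover S ∧ S.ncard ≤ k := by
  rintro ⟨S, hS, hc⟩
  exact not_spreadAlarm_of_forall_dist_le N.connected
    (dist_le_two_mul_of_isVertexCover N.connected hS hc) v h

/-! ### Sizes of identifiers -/

theorem size_le_mul_logb {n d x : ℕ} (hn : 2 ≤ n) (hx : x < n ^ d) :
    (x.size : ℝ) ≤ (d + 1) * Real.logb 2 n := by
  have hlog : 1 ≤ Real.logb 2 n := by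
    rw [Real.le_logb_iff_rpow_le one_lt_two (by positivity)]
    simpa using (by exact_mod_cast hn : (2 : ℝ) ≤ n)
  rcases Nat.eq_zero_or_pos x with rfl | h0
  · simp only [Nat.size_zero, Nat.cast_zero]
    positivity
  · have hs : 0 < x.size := Nat.size_pos.mpr h0
    have h1 : 2 ^ (x.size - 1) ≤ x := Nat.lt_size.mp (by omega)
    have h2 : (2 : ℝ) ^ (x.size - 1) ≤ (n : ℝ) ^ d := by exact_mod_cast h1.trans hx.le
    have h3 := Real.logb_le_logb_of_le one_lt_two (by positivity) h2
    rw [Real.logb_pow, Real.logb_pow, Real.logb_self_eq_one one_lt_two, mul_one,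
      Nat.cast_sub hs] at h3
    push_cast at h3
    linarith

/-- Distinct identifiers up to `m` force `n ≤ m + 1`; this lets `m.size` stand in for the unknown
`log n`. -/
theorem logb_card_le_size {m : ℕ} (hident : ∀ v, N.ident v ≤ m) :
    Real.logb 2 (Fintype.card V) ≤ m.size := by
  rcases Nat.eq_zero_or_pos (Fintype.card V) with h | h
  · simp [h]
  have h1 : Fintype.card V ≤ m + 1 := by
    have := Fintype.card_le_of_injective (fun v => (⟨N.ident v, Nat.lt_succ_of_le (hident v)⟩ :
      Fin (m + 1))) fun u v huv => N.ident_injective (by simpa using huv)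
    simpa using this
  have h2 : Fintype.card V ≤ 2 ^ m.size := h1.trans (Nat.lt_size_self m)
  rw [Real.logb_le_iff_le_rpow one_lt_two (by exact_mod_cast h), Real.rpow_natCast]
  exact_mod_cast h2

/-! ### The running time -/

theorem sum_broadcastRounds (k e m : ℕ) :
    ∑ i ∈ range (6 * k + 2 + floodLength k e m), broadcastRounds k e m i =
      6 * k + 1 + roundsPerBroadcast k e m * (floodLength k e m + 1) := by
  rw [show 6 * k + 2 + floodLength k e m = 6 * k + 1 + (floodLength k e m + 1) by ring,
    sum_range_add]
  have h1 : ∀ i ∈ range (6 * k + 1), broadcastRounds k e m i = 1 := fun i hi =>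
    if_pos (mem_range.mp hi)
  have h2 : ∀ i ∈ range (floodLength k e m + 1),
      broadcastRounds k e m (6 * k + 1 + i) = roundsPerBroadcast k e m := fun i _ =>
    if_neg (by omega)
  rw [sum_congr rfl h1, sum_congr rfl h2]
  simp [mul_comm]

/-- With `w` bits per item, `p` rounds and `q` items per broadcast, `p ≤ 2 * (w / m.size) * q` holds
whichever of `w` and `m.size` is larger. The factor `q` cancels in the pipeline term. -/
theorem roundsPerBroadcast_mul_floodLength_le (k e : ℕ) {m : ℕ} (hm : 0 < m.size) :
    (roundsPerBroadcast k e m * (floodLength k e m + 1) : ℝ) ≤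
      (itemBits k e m / m.size + 1) * (4 * k + 2) +
        4 * k ^ 2 * (itemBits k e m / m.size) := by
  set w := itemBits k e m with hw
  have hw0 : (0 : ℝ) < w := by exact_mod_cast (Nat.succ_pos _ : 0 < itemBits k e m)
  have hb0 : (0 : ℝ) < m.size := by exact_mod_cast hm
  set p := roundsPerBroadcast k e m with hp
  set q := itemsPerBroadcast k e m with hq
  have hp1 : (p : ℝ) ≤ w / m.size + 1 := by
    rw [hp, roundsPerBroadcast]
    push_cast
    exact add_le_add_left Nat.cast_div_le 1
  have hq1 : (m.size : ℝ) / w ≤ q := by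
    rw [div_le_iff₀ hw0]
    have := (Nat.lt_mul_div_succ m.size (Nat.succ_pos _ : 0 < itemBits k e m)).le
    rw [mul_comm] at this
    exact_mod_cast this
  have hq2 : (1 : ℝ) ≤ q := by exact_mod_cast (Nat.le_add_left 1 _ : 1 ≤ q)
  have hpq : (p : ℝ) ≤ 2 * (w / m.size) * q := by
    calc (p : ℝ) ≤ w / m.size + 1 := hp1
      _ = w / m.size * (1 + m.size / w) := by field_simp
      _ ≤ w / m.size * (2 * q) := by gcongr; linarith
      _ = _ := by ring
  have hdiv : ((2 * k ^ 2 / q : ℕ) : ℝ) ≤ 2 * k ^ 2 / q := by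
    refine Nat.cast_div_le.trans ?_
    push_cast
    exact le_rfl
  have hF : (floodLength k e m : ℝ) = 4 * k + (2 * k ^ 2 / q : ℕ) + 1 := by
    rw [floodLength]
    push_cast
    rfl
  rw [hF]
  calc (p : ℝ) * (4 * k + (2 * k ^ 2 / q : ℕ) + 1 + 1)
      = p * (4 * k + 2) + p * (2 * k ^ 2 / q : ℕ) := by ring
    _ ≤ (w / m.size + 1) * (4 * k + 2) + 2 * (w / m.size) * q * (2 * k ^ 2 / q) := by gcongr
    _ = _ := by field_simp; ring

theorem rounds_le {n m e : ℕ} (hn : 2 ≤ n) (he : 1 ≤ e) (hk : 1 ≤ k)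
    (hm : Real.logb 2 n ≤ m.size) :
    ((6 * k + 1 + roundsPerBroadcast k e m * (floodLength k e m + 1) : ℕ) : ℝ) ≤
      (90 * e + 55) * (k + (k : ℝ) ^ 2 * Real.log k / Real.log n) := by
  have hlogn : 1 ≤ Real.logb 2 n := by
    rw [Real.le_logb_iff_rpow_le one_lt_two (by positivity)]
    simpa using (by exact_mod_cast hn : (2 : ℝ) ≤ n)
  have hb1 : (1 : ℝ) ≤ m.size := hlogn.trans hm
  have hb : 0 < m.size := by exact_mod_cast hb1
  have hmain := roundsPerBroadcast_mul_floodLength_le k e hb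
  have he' : (1 : ℝ) ≤ e := by exact_mod_cast he
  push_cast
  rcases hk.eq_or_lt with rfl | hk
  -- For `k = 1` the logarithmic term of the bound vanishes, but items have only `4 * m.size + 1`
  -- bits, so a constant number of rounds is enough.
  · have hw : (itemBits 1 e m : ℝ) / m.size ≤ 5 := by
      rw [div_le_iff₀ (by positivity), itemBits, labelBits, if_pos le_rfl]
      push_cast
      linarith
    simp only [Nat.cast_one, Real.log_one, mul_zero, zero_div] at hmain ⊢
    nlinarith
  · have hk2 : (2 : ℝ) ≤ k := by exact_mod_cast hk
    have hlogk : 1 ≤ Real.logb 2 k := by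
      rw [Real.le_logb_iff_rpow_le one_lt_two (by positivity)]
      simpa using hk2
    have hsize : (k.size : ℝ) ≤ 2 * Real.logb 2 k := by
      have h1 : 2 ^ (k.size - 1) ≤ k := Nat.lt_size.mp (by
        have := Nat.size_pos.mpr (by omega : 0 < k)
        omega)
      have h2 : (2 : ℝ) ^ (k.size - 1) ≤ (k : ℝ) := by exact_mod_cast h1
      have h3 := Real.logb_le_logb_of_le one_lt_two (by positivity) h2
      rw [Real.logb_pow, Real.logb_self_eq_one one_lt_two, mul_one,
        Nat.cast_sub (Nat.size_pos.mpr (by omega))] at h3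
      push_cast at h3
      linarith
    have hs1 : (1 : ℝ) ≤ k.size := by
      exact_mod_cast Nat.size_pos.mpr (by omega : 0 < k)
    set ρ := Real.log k / Real.log n with hρ
    have hρ' : ρ = Real.logb 2 k / Real.logb 2 n := by
      rw [Real.logb, Real.logb, div_div_div_cancel_right₀ (Real.log_pos one_lt_two).ne']
    have hρ0 : 0 ≤ ρ := by rw [hρ']; positivity
    have hw : (itemBits k e m : ℝ) / m.size ≤ 10 * e * ρ := by
      have h1 : (itemBits k e m : ℝ) ≤ 10 * e * Real.logb 2 k := by
        rw [itemBits, labelBits, if_neg (by omega)]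
        push_cast
        have : (1 : ℝ) ≤ e * k.size := one_le_mul_of_one_le_of_one_le he' hs1
        calc 4 * (e * k.size : ℝ) + 1 ≤ 5 * (e * k.size) := by linarith
          _ ≤ 5 * (e * (2 * Real.logb 2 k)) := by gcongr
          _ = _ := by ring
      rw [hρ', ← mul_div_assoc]
      exact div_le_div₀ (by positivity) h1 (by linarith) hm
    set y := (itemBits k e m : ℝ) / m.size with hy
    have hy0 : 0 ≤ y := by positivity
    have hkk : (4 * k + 2 : ℝ) ≤ 5 * k := by linarith
    have hk3 : (k : ℝ) ≤ k ^ 2 := by nlinarith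
    calc (6 * k + 1 + roundsPerBroadcast k e m * (floodLength k e m + 1) : ℝ)
        ≤ 6 * k + 1 + ((y + 1) * (4 * k + 2) + 4 * k ^ 2 * y) := by linarith
      _ ≤ 6 * k + 1 + ((y + 1) * (5 * k) + 4 * k ^ 2 * y) := by gcongr
      _ = 11 * k + 1 + 5 * (k * y) + 4 * (k ^ 2 * y) := by ring
      _ ≤ 12 * k + 5 * (k ^ 2 * y) + 4 * (k ^ 2 * y) := by
        have := mul_le_mul_of_nonneg_right hk3 hy0
        linarith
      _ = 12 * k + 9 * (k ^ 2 * y) := by ring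
      _ ≤ 12 * k + 9 * (k ^ 2 * (10 * e * ρ)) := by gcongr
      _ = 12 * k + 90 * e * (k ^ 2 * ρ) := by ring
      _ ≤ (90 * e + 55) * k + (90 * e + 55) * (k ^ 2 * ρ) := by
        gcongr <;> linarith
      _ = _ := by rw [hρ]; ring

end

/-! ### Collision probability and assembly. -/

section

/-! ### Label collisions -/

/-- Overwriting the value at `u` by an arbitrary one is injective on colliding families, since the
old value survives at `v`. -/
theorem card_filter_eq_mul_le {V X : Type} [Fintype V] [Fintype X] {u v : V} (huv : u ≠ v) :
    #(univ.filter fun ω : V → X => ω u = ω v) * Fintype.card X ≤ Fintype.card (V → X) := by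
  rw [← card_univ, ← card_univ, ← card_product]
  refine card_le_card_of_injOn (fun p => Function.update p.1 u p.2) (fun _ _ => mem_univ _) ?_
  rintro ⟨ω, x⟩ h ⟨ω', x'⟩ h' heq
  simp only [coe_product, Set.mem_prod, mem_coe, mem_filter, mem_univ, true_and, and_true] at h h'
  have hx : x = x' := by simpa using congrFun heq u
  have hoff : ∀ w, w ≠ u → ω w = ω' w := fun w hw => by simpa [hw] using congrFun heq w
  refine Prod.ext (funext fun w => ?_) hx
  change ω w = ω' w
  by_cases hw : w = u
  · rw [hw, h, h', hoff v huv.symm]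
  · exact hoff w hw

theorem card_not_injOn_mul_le {V X : Type} [Fintype V] [Fintype X] (W : Finset V) :
    #(univ.filter fun ω : V → X => ¬ Set.InjOn ω W) * Fintype.card X ≤
      #W ^ 2 * Fintype.card (V → X) := by
  have hsub : (univ.filter fun ω : V → X => ¬ Set.InjOn ω W) ⊆
      W.offDiag.biUnion fun p => univ.filter fun ω : V → X => ω p.1 = ω p.2 := by
    intro ω hω
    have hω := (mem_filter.mp hω).2
    simp only [Set.InjOn] at hω
    push Not at hω
    obtain ⟨u, hu, v, hv, h, hne⟩ := hω
    exact mem_biUnion.mpr ⟨(u, v), mem_offDiag.mpr ⟨hu, hv, hne⟩, by simpa using h⟩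
  calc _ ≤ (∑ p ∈ W.offDiag, #(univ.filter fun ω : V → X => ω p.1 = ω p.2)) *
        Fintype.card X := Nat.mul_le_mul_right _ ((card_le_card hsub).trans card_biUnion_le)
    _ = ∑ p ∈ W.offDiag, #(univ.filter fun ω : V → X => ω p.1 = ω p.2) * Fintype.card X :=
        sum_mul _ _ _
    _ ≤ ∑ _p ∈ W.offDiag, Fintype.card (V → X) :=
        sum_le_sum fun p hp => card_filter_eq_mul_le (mem_offDiag.mp hp).2.2
    _ ≤ #W ^ 2 * Fintype.card (V → X) := by
        rw [sum_const, smul_eq_mul, offDiag_card, sq]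
        exact Nat.mul_le_mul_right _ (Nat.sub_le _ _)

theorem one_sub_le_successProbability (A : Protocol) {V : Type} [Fintype V] (N : Network V)
    (k t : ℕ) (bad : Finset (A.Coins V))
    (h : ∀ ω ∉ bad, SolvesVertexCover N.graph k (A.result N ω t)) :
    1 - (#bad : ℝ) / Fintype.card (A.Coins V) ≤ successProbability A N k t := by
  rw [successProbability, MeasureTheory.measureReal_def,
    PMF.toMeasure_uniformOfFintype_apply _ (Set.toFinite _).measurableSet, ENNReal.toReal_div,
    ENNReal.toReal_natCast, ENNReal.toReal_natCast]
  have hpos : (0 : ℝ) < Fintype.card (A.Coins V) := by exact_mod_cast Fintype.card_pos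
  rw [one_sub_div hpos.ne']
  gcongr
  have hsub : badᶜ ⊆ {ω | SolvesVertexCover N.graph k (A.result N ω t)}.toFinset := fun ω hω => by
    simpa using h ω (mem_compl.mp hω)
  have hc := card_le_card hsub
  rw [card_compl, Set.toFinset_card] at hc
  have : Fintype.card (A.Coins V) ≤
      Fintype.card {ω | SolvesVertexCover N.graph k (A.result N ω t)} + #bad := by omega
  rw [sub_le_iff_le_add]
  exact_mod_cast this

variable {V : Type} [Fintype V] {N : Network V} {k e : ℕ}

/-- The algorithm works if labels do not collide on the certificate. -/
theorem exists_rounds (he : 1 ≤ e) (hk : 1 ≤ k) {d : ℕ} (hn : 2 ≤ Fintype.card V)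
    (hident : ∀ v, N.ident v < Fintype.card V ^ d) :
    (coverAlgorithm k e).toProtocol.MessagesAtMost N
      ((2 * d + 3) * Real.logb 2 (Fintype.card V)) ∧
    ∃ t : ℕ, (t : ℝ) ≤ (90 * e + 55) *
        (k + (k : ℝ) ^ 2 * Real.log k / Real.log (Fintype.card V)) ∧
      (coverAlgorithm k e).toProtocol.TerminatesWithin N t ∧
      ∃ W : Finset V, #W ≤ 2 * (2 * k ^ 2 + 1) ∧ ∀ ω : V → Fin (e * k.size) → Bool,
        Set.InjOn (networkLabel N k e ω) W →
        SolvesVertexCover N.graph k ((coverAlgorithm k e).toProtocol.result N ω t) := by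
  set n := Fintype.card V
  have hlogn : 1 ≤ Real.logb 2 n := by
    rw [Real.le_logb_iff_rpow_le one_lt_two (by positivity)]
    simpa using (by exact_mod_cast hn : (2 : ℝ) ≤ n)
  have hlog0 : 0 ≤ Real.log k / Real.log n :=
    div_nonneg (Real.log_natCast_nonneg k) (Real.log_natCast_nonneg n)
  have hwidth : ∀ u, ((2 * (N.ident u).size + 1 : ℕ) : ℝ) ≤ (2 * d + 3) * Real.logb 2 n := by
    intro u
    have := size_le_mul_logb hn (hident u)
    push_cast
    nlinarith
  have hb0 : (0 : ℝ) ≤ (2 * d + 3) * Real.logb 2 n := by positivity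
  rcases networkAlarm_dichotomy N k with halarm | ⟨halarm, l, hl, hm, hdist⟩
  · have hlock := fun ω : V → Fin (e * k.size) → Bool =>
      lockstep_of_networkAlarm (ω := ω) hk halarm
    have hres : ∀ (ω : V → Fin (e * k.size) → Bool) v, (coverAlgorithm k e).toProtocol.result N ω (6 * k + 1) v =
        some .noSolution := by
      intro ω v
      have := (hlock ω).result_eq v
      simp only [sum_const, card_range, smul_eq_mul, mul_one] at this
      rw [this, trajectory_after_warn hk, if_pos (halarm v)]
      rfl
    refine ⟨fun (ω : V → Fin (e * k.size) → Bool) t v p _ => (hlock ω).length_message_le (fun i hi v => ?_) hb0 t v p,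
      6 * k + 1, ?_, fun (ω : V → Fin (e * k.size) → Bool) v => by rw [hres]; rfl, ∅, by simp, fun ω _ => ⟨fun hex => ?_, ?_⟩⟩
    · obtain ⟨u, hu⟩ := (trajectory_before_greet (ω := ω) (e := e) hk hi v).2.2.2
      exact (Nat.cast_le.mpr hu).trans (hwidth u)
    · have h1 : (1 : ℝ) ≤ k := by exact_mod_cast hk
      have h2 : 0 ≤ (k : ℝ) ^ 2 * Real.log k / Real.log n := by
        rw [mul_div_assoc]; positivity
      have h3 : (0 : ℝ) ≤ e := by positivity
      push_cast
      calc (6 * k + 1 : ℝ) ≤ 55 * k := by linarith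
        _ ≤ _ := by gcongr <;> linarith
    · obtain ⟨v⟩ := N.connected.nonempty
      exact absurd hex (not_exists_vertexCover_of_networkAlarm (halarm v))
    · exact fun _ v => hres ω v
  · have hlogm := logb_card_le_size (N := N) hl
    have hpos : 0 < (N.ident l).size := by
      have : (1 : ℝ) ≤ (N.ident l).size := hlogn.trans hlogm
      exact_mod_cast this
    have hlock := fun ω : V → Fin (e * k.size) → Bool =>
      lockstep_of_not_networkAlarm (ω := ω) hk halarm hm hl hpos
    obtain ⟨F, hF, hFc, hF1, hF2⟩ := exists_certificate N.graph k
    refine ⟨fun (ω : V → Fin (e * k.size) → Bool) t v p _ => (hlock ω).length_message_le (fun i hi v => ?_) hb0 t v p,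
      ∑ i ∈ range (6 * k + 2 + floodLength k e (N.ident l)), broadcastRounds k e (N.ident l) i,
      ?_, fun ω v => ?_, endpoints F, (card_endpoints_le F).trans (by omega), fun ω hω => ?_⟩
    · rcases Nat.lt_or_ge i (6 * k + 1) with h | h
      · obtain ⟨u, hu⟩ := (trajectory_before_greet (ω := ω) (e := e) hk h v).2.2.2
        exact (Nat.cast_le.mpr hu).trans (hwidth u)
      · rw [(trajectory_from_greet hk halarm hm hl hpos h hi v).2.2.1]
        exact (Nat.cast_le.mpr (Nat.le_succ _)).trans (hwidth l)
    · rw [sum_broadcastRounds]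
      exact rounds_le hn he hk hlogm
    · rw [(hlock ω).result_eq]
      exact (hlock ω).halts v
    · have hres := fun v => (hlock ω).result_eq v
      simp only [output_trajectory_eq hk halarm hm hdist] at hres
      rw [funext hres]
      exact solvesVertexCover_decideVerdict hk hF hF1 hF2 hω

omit [Fintype V] in
theorem networkLabel_injOn_iff (hk : 2 ≤ k) (W : Finset V) (ω : V → Fin (e * k.size) → Bool) :
    Set.InjOn (networkLabel N k e ω) W ↔ Set.InjOn ω W := by
  have : networkLabel N k e ω =
      (fun c : Fin (e * k.size) → Bool => (Fintype.equivFin _ c : ℕ)) ∘ ω := by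
    funext v
    rw [networkLabel, vertexLabel, if_neg (by omega)]
    rfl
  rw [this]
  have hinj : Function.Injective fun c : Fin (e * k.size) → Bool => (Fintype.equivFin _ c : ℕ) :=
    Fin.val_injective.comp (Fintype.equivFin _).injective
  exact ⟨fun h => h.of_comp, fun h => hinj.comp_injOn h⟩

/-- The left side is at most `64 * k ^ (c + 4)`, where `64 = 4 ^ 3` costs three factors `2 ^ k.size`
and the power of `k` costs `c + 4`; this is the origin of `c + 7`. -/
theorem mul_pow_le_two_pow (hk : 2 ≤ k) (c : ℕ) :
    (2 * (2 * k ^ 2 + 1)) ^ 2 * k ^ c ≤ 2 ^ ((c + 7) * k.size) := by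
  have h1 : k ≤ 2 ^ k.size := (Nat.lt_size_self k).le
  have h2 : 2 ^ 2 ≤ 2 ^ k.size := Nat.pow_le_pow_right two_pos (Nat.lt_size.mpr (by simpa using hk))
  have h3 : 2 * (2 * k ^ 2 + 1) ≤ 8 * k ^ 2 := by nlinarith
  calc (2 * (2 * k ^ 2 + 1)) ^ 2 * k ^ c ≤ (8 * k ^ 2) ^ 2 * k ^ c := by gcongr
    _ = (2 ^ 2) ^ 3 * k ^ (c + 4) := by ring
    _ ≤ (2 ^ k.size) ^ 3 * (2 ^ k.size) ^ (c + 4) := by gcongr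
    _ = _ := by rw [← pow_add, ← pow_mul]; congr 1; ring

theorem one_sub_le_successProbability_of_injOn {A : Protocol} {t : ℕ} (W : Finset V)
    (h : ∀ ω : A.Coins V, Set.InjOn ω W → SolvesVertexCover N.graph k (A.result N ω t)) :
    1 - (#W : ℝ) ^ 2 / 2 ^ A.numCoins ≤ successProbability A N k t := by
  refine le_trans (sub_le_sub_left ?_ 1) (one_sub_le_successProbability A N k t
    (univ.filter fun ω : A.Coins V => ¬ Set.InjOn ω W) fun ω hω => h ω ?_)
  · have hX : Fintype.card (Fin A.numCoins → Bool) = 2 ^ A.numCoins := by simp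
    have hcard : #(univ.filter fun ω : A.Coins V => ¬ Set.InjOn ω W) * 2 ^ A.numCoins ≤
        #W ^ 2 * Fintype.card (A.Coins V) := by
      rw [← hX]
      convert card_not_injOn_mul_le (X := Fin A.numCoins → Bool) W
    have hT : (0 : ℝ) < Fintype.card (A.Coins V) := by exact_mod_cast Fintype.card_pos
    rw [div_le_div_iff₀ hT (by positivity)]
    have := (Nat.cast_le (α := ℝ)).mpr hcard
    simpa only [Nat.cast_mul, Nat.cast_pow, Nat.cast_ofNat] using this
  · by_contra hc
    exact hω (mem_filter.mpr ⟨mem_univ _, hc⟩)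

theorem sq_div_two_pow_le {w c : ℕ} (hk : 2 ≤ k) (hw : w ≤ 2 * (2 * k ^ 2 + 1)) :
    (w : ℝ) ^ 2 / 2 ^ ((c + 7) * k.size) ≤ ((k : ℝ) ^ c)⁻¹ := by
  rw [← one_div, div_le_div_iff₀ (by positivity) (by positivity), one_mul]
  exact_mod_cast (Nat.mul_le_mul_right _ (Nat.pow_le_pow_left hw 2)).trans
    (mul_pow_le_two_pow hk c)

theorem successProbability_eq_one {A : Protocol} {t : ℕ}
    (h : ∀ ω, SolvesVertexCover N.graph k (A.result N ω t)) :
    1 ≤ successProbability A N k t := by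
  simpa using one_sub_le_successProbability A N k t ∅ fun ω _ => h ω

/-- For `k = 0` the algorithm answers at once. -/
theorem zero_rounds (hn : 2 ≤ Fintype.card V) (e : ℕ) (ω : V → Fin (e * Nat.size 0) → Bool) :
    (∀ v, (coverAlgorithm 0 e).toProtocol.result N ω 0 v = some .noSolution) ∧
    SolvesVertexCover N.graph 0 ((coverAlgorithm 0 e).toProtocol.result N ω 0) := by
  have hres : ∀ v, (coverAlgorithm 0 e).toProtocol.result N ω 0 v = some .noSolution := fun v => rfl
  refine ⟨hres, fun ⟨S, hS, hc⟩ => ?_, fun _ => hres⟩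
  have hdist := dist_le_two_mul_of_isVertexCover N.connected hS hc
  obtain ⟨u, v, huv⟩ := Fintype.one_lt_card_iff.mp hn
  have := hdist u v
  rw [mul_zero, Nat.le_zero, N.connected.dist_eq_zero_iff] at this
  exact absurd this huv

theorem lockstep_zero (e : ℕ) (ω : V → Fin (e * Nat.size 0) → Bool) :
    (coverAlgorithm 0 e).Lockstep N ω 0 fun _ => 0 where
  output_eq_none i hi := absurd hi (Nat.not_lt_zero i)
  duration_eq i hi := absurd hi (Nat.not_lt_zero i)
  duration_pos i hi := absurd hi (Nat.not_lt_zero i)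
  length_le i hi := absurd hi (Nat.not_lt_zero i)
  halts _ := rfl

end

end Congest

end

theorem mainTheorem5 :
    -- identifiers are smaller than `n ^ d`, messages have at most `B * log₂ n` bits
    ∀ d : ℕ, ∃ B : ℝ, ∀ c : ℝ, ∃ C : ℝ, ∀ δ : ℕ → ℝ,
      (∀ k : ℕ, 0 ≤ δ k) → (∀ k : ℕ, 2 ≤ k → (k : ℝ) ^ (-c) ≤ δ k) →
      ∃ A : ℕ → Congest.Protocol,
        ∀ (k : ℕ) (V : Type) [Fintype V] (N : Congest.Network V),
          2 ≤ Fintype.card V → (∀ v, N.ident v < Fintype.card V ^ d) →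
          (A k).MessagesAtMost N (B * Real.logb 2 (Fintype.card V)) ∧
          ∃ t : ℕ,
            (t : ℝ) ≤ C * (k + (k : ℝ) ^ 2 * Real.log k / Real.log (Fintype.card V)) ∧
            (A k).TerminatesWithin N t ∧
            1 - δ k ≤ Congest.successProbability (A k) N k t := by
  intro d
  -- An identifier has at most `(d + 1) * log₂ n` bits and its code twice as many plus one. The
  -- label length factor is `⌈c⌉₊ + 7`.
  refine ⟨2 * d + 3, fun c => ⟨90 * (⌈c⌉₊ + 7 : ℕ) + 55, fun δ hδ0 hδ =>
    ⟨fun k => (Congest.coverAlgorithm k (⌈c⌉₊ + 7)).toProtocol, fun k V _ N hn hident => ?_⟩⟩⟩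
  rcases Nat.eq_zero_or_pos k with rfl | hk
  · have hlog : 0 ≤ Real.logb 2 (Fintype.card V) :=
      Real.logb_nonneg one_lt_two (by exact_mod_cast (by omega : 1 ≤ Fintype.card V))
    refine ⟨fun ω t v p _ => (Congest.lockstep_zero _ ω).length_message_le
      (fun i hi => absurd hi (Nat.not_lt_zero i)) (by positivity) t v p, 0, by simp,
      fun ω v => ?_, ?_⟩
    · rw [(Congest.zero_rounds hn _ ω).1]
      rfl
    · exact le_trans (by linarith [hδ0 0]) (Congest.successProbability_eq_one
        fun ω => (Congest.zero_rounds hn (⌈c⌉₊ + 7) ω).2)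
  · obtain ⟨hmsg, t, ht, hterm, W, hW, hsolve⟩ :=
      Congest.exists_rounds (e := ⌈c⌉₊ + 7) (by omega) hk hn hident
    refine ⟨hmsg, t, ht, hterm, ?_⟩
    rcases (Nat.succ_le_of_lt hk).eq_or_lt with rfl | hk2
    -- For `k = 1` the labels are the identifiers, so they never collide.
    · refine le_trans (by linarith [hδ0 1]) (Congest.successProbability_eq_one fun ω => ?_)
      refine hsolve ω (Set.injOn_of_injective ?_)
      exact N.ident_injective
    · refine le_trans ?_ (Congest.one_sub_le_successProbability_of_injOn W fun ω hω =>
        hsolve ω ((Congest.networkLabel_injOn_iff hk2 W ω).mpr hω))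
      refine sub_le_sub_left ((Congest.sq_div_two_pow_le hk2 hW).trans (le_trans ?_ (hδ k hk2))) 1
      rw [← Real.rpow_natCast, ← Real.rpow_neg (Nat.cast_nonneg k)]
      exact Real.rpow_le_rpow_of_exponent_le (by exact_mod_cast hk)
        (neg_le_neg (Nat.le_ceil c))
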